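/- **Setting.** Let $\mathbb S^2\subset\mathbb R^3$ be the unit sphere with geodesic distance $\tilde d(x,y)=\arccos(x\cdot y)$. For $0\le m\le \ell$ let $$Y_{\ell,m}(\theta,\varphi)=\sqrt{\tfrac{(2\ell+1)(\ell-m)!}{(\ell+m)!}}\,P_{\ell,m}(\cos\theta)\,e^{\mathrm i m\varphi}$$ be the spherical harmonics in spherical coordinates, where $P_{\ell,m}(s)=(-1)^m(1-s^2)^{m/2}P_\ell^{(m)}(s)$ and $P_\ell$ is the Legendre polynomial of degree $\ell$; they are orthonormal for the normalized surface measure. Put $\lambda_\ell=\ell(\ell+1)$, and let $E_\alpha(z)=\sum_{k\ge0} z^k/\Gamma(\alpha k+1)$ be the Mittag-Leffler function. Fix $0<\alpha\le1$ and $\tau\ge0$. Let $(\mathcal C_\ell)_{\ell\ge0}$ and $(\mathcal A_\ell)_{\ell\ge0}$ be non-negative sequences (the angular power spectra of the initial field and of the noise). On a probability space let $Z^{(1)}_{\ell,m}$ ($0\le m\le\ell$) and $Z^{(2)}_{\ell,m}$ ($1\le m\le\ell$) be independent standard normal variables, and let $\beta^{(1)}_{\ell,m}$ ($0\le m\le\ell$)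 and $\beta^{(2)}_{\ell,m}$ ($1\le m\le\ell$) be independent standard real Brownian motions, the two families being independent of each other. For $t>0$ put $$U^H_\ell(x,t)=E_\alpha(-\lambda_\ell t^\alpha)\Big(\sqrt{\mathcal C_\ell}\,Z^{(1)}_{\ell,0}Y_{\ell,0}(x)+\sqrt{2\mathcal C_\ell}\sum_{m=1}^{\ell}\big(Z^{(1)}_{\ell,m}\,\Re Y_{\ell,m}(x)+Z^{(2)}_{\ell,m}\,\Im Y_{\ell,m}(x)\big)\Big),$$ let $U^I_\ell(x,t)=0$ for $t\le\tau$, and for $t>\tau$ put $$U^I_\ell(x,t)=\sqrt{\mathcal A_\ell}\,\mathcal I^{(1)}_{\ell,0}(t-\tau)Y_{\ell,0}(x)+\sqrt{2\mathcal A_\ell}\sum_{m=1}^{\ell}\big(\mathcal I^{(1)}_{\ell,m}(t-\tau)\,\Re Y_{\ell,m}(x)+\mathcal I^{(2)}_{\ell,m}(t-\tau)\,\Im Y_{\ell,m}(x)\big),$$ where $\mathcal I^{(j)}_{\ell,m}(T)=\int_0^{T}E_\alpha(-\lambda_\ell(T-u)^\alpha)\,d\beta^{(j)}_{\ell,m}(u)$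 is a Wiener integral. Let $U$ be the random field $$U(x,t)=\sum_{\ell=0}^\infty\big(U^H_\ell(x,t)+U^I_\ell(x,t)\big),\qquad x\in\mathbb S^2,\ t>0,$$ the series converging in $L_2(\Omega)$ at every point $x$. (This is the series solution of the time-fractional stochastic diffusion equation $dU-D_t^{1-\alpha}\Delta_{\mathbb S^2}U\,dt=dW_\tau$, whose noise $W_\tau$ is switched on at time $\tau$, with an isotropic Gaussian initial field.) **Theorem.** Let $\beta^*\in(0,1]$ and $\kappa_1,\kappa_2>2(1+\beta^*)$, and suppose that there are constants $\widetilde D,\widetilde C,\widetilde K,\widetilde A>0$ with $\mathcal C_0\le\widetilde D$, $\mathcal A_0\le\widetilde K$, and $\mathcal C_\ell\le\widetilde C\,\ell^{-\kappa_1}$, $\mathcal A_\ell\le\widetilde A\,\ell^{-\kappa_2}$ for all $\ell\ge1$. Then $$K^{(1)}_{\beta^*}:=\sum_{\ell\ge1}\ell^{1+2\beta^*}\mathcal C_\ell<\infty,\qquad K^{(2)}_{\beta^*}:=\sum_{\ell\ge1}\ell^{1+2\beta^*}\mathcal A_\ell<\infty,$$ and for every $t>0$ the following hold. 1. For all $x,y\in\mathbb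 S^2$, $$\operatorname{Var}[U(x,t)-U(y,t)]\le K_{\beta^*}(t)\,\tilde d(x,y)^{2\beta^*},\qquad K_{\beta^*}(t)=2^{4-\beta^*}\begin{cases}K^{(1)}_{\beta^*},&t\le\tau,\\ K^{(1)}_{\beta^*}+(t-\tau)K^{(2)}_{\beta^*},&t>\tau.\end{cases}$$ 2. There is a jointly measurable random field $V$ on $\mathbb S^2$ with $V(x)=U(x,t)$ almost surely for every $x\in\mathbb S^2$ (a modification of $U(\cdot,t)$), all of whose sample paths are locally Hölder continuous, with respect to $\tilde d$, of every order $\gamma^*\in(0,\beta^*)$. -/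

import Mathlib

open MeasureTheory ProbabilityTheory Filter Topology
open scoped NNReal ENNReal

noncomputable section

/-! ### The sphere, Legendre functions and spherical harmonics -/

/-- The unit sphere of Euclidean three-space. -/
abbrev Sphere2 : Type := Metric.sphere (0 : EuclideanSpace ℝ (Fin 3)) 1

/-- The geodesic distance `arccos (x · y)` on the unit sphere. -/
def geodesicDist (x y : Sphere2) : ℝ :=
  Real.arccos (inner ℝ (x : EuclideanSpace ℝ (Fin 3)) (y : EuclideanSpace ℝ (Fin 3)))

/-- The Legendre polynomial of degree `l` (Rodrigues' formula). -/
def legendrePoly (l : ℕ) : Polynomial ℝ :=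
  Polynomial.C ((2 : ℝ) ^ l * (l.factorial : ℝ))⁻¹ *
    Polynomial.derivative^[l] ((Polynomial.X ^ 2 - 1) ^ l)

/-- The associated Legendre function
`P_{l,m}(s) = (-1)^m (1 - s^2)^{m/2} (d/ds)^m P_l(s)` for `s ∈ [-1, 1]`. -/
def assocLegendre (l m : ℕ) (s : ℝ) : ℝ :=
  (-1) ^ m * Real.sqrt (1 - s ^ 2) ^ m * (Polynomial.derivative^[m] (legendrePoly l)).eval s

/-- The complex spherical harmonic `Y_{l,m}`, `0 ≤ m ≤ l`, in spherical coordinates, orthonormal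
for the normalized surface measure. -/
def sphHarmAngles (l m : ℕ) (θ φ : ℝ) : ℂ :=
  (Real.sqrt ((2 * (l : ℝ) + 1) * ((l - m).factorial : ℝ) / ((l + m).factorial : ℝ)) : ℂ) *
    (assocLegendre l m (Real.cos θ) : ℂ) * Complex.exp (Complex.I * (m : ℂ) * (φ : ℂ))

/-- `Y_{l,m}` as a function on the sphere: the polar angle of `x` is `arccos x₃` and its azimuth is
the argument of `x₁ + i x₂`.  (The range of the azimuth and its value at the poles do not
matter: `exp (i m φ)` has period `2π`, and `P_{l,m}(±1) = 0` for `m ≥ 1`.) -/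
def sphHarm (l m : ℕ) (x : Sphere2) : ℂ :=
  sphHarmAngles l m (Real.arccos (x.1 2)) (Complex.arg ⟨x.1 0, x.1 1⟩)

/-- The eigenvalue `l (l + 1)` of minus the Laplace-Beltrami operator. -/
def sphEigenvalue (l : ℕ) : ℝ := (l : ℝ) * ((l : ℝ) + 1)

/-! ### The Mittag-Leffler function -/

/-- The Mittag-Leffler function `E_α(z) = ∑_{k ≥ 0} z^k / Γ(α k + 1)` on the real line. -/
def mittagLeffler (α z : ℝ) : ℝ := ∑' k : ℕ, z ^ k / Real.Gamma (α * (k : ℝ) + 1)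

/-! ### The Wiener integral of a deterministic function -/

/-- Data of a step function on `(0, T]`: the points `0 = p_0 ≤ p_1 ≤ … ≤ p_n = T` and the
values on the intervals `(p_i, p_{i+1}]`. -/
structure StepData (T : ℝ≥0) where
  /-- number of intervals -/
  n : ℕ
  /-- the partition points -/
  pts : Fin (n + 1) → ℝ≥0
  /-- the values -/
  vals : Fin n → ℝ
  mono : Monotone pts
  first : pts 0 = 0
  last : pts (Fin.last n) = T

/-- The step function itself. -/
def StepData.toFun {T : ℝ≥0} (s : StepData T) (u : ℝ) : ℝ :=
  ∑ i : Fin s.n,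
    Set.indicator (Set.Ioc (s.pts i.castSucc : ℝ) (s.pts i.succ : ℝ)) (fun _ => s.vals i) u

/-- The elementary stochastic integral of a step function against a process `B`. -/
def StepData.integral {Ω : Type*} {T : ℝ≥0} (s : StepData T) (B : ℝ≥0 → Ω → ℝ) (ω : Ω) : ℝ :=
  ∑ i : Fin s.n, s.vals i * (B (s.pts i.succ) ω - B (s.pts i.castSucc) ω)

/-- `J` is (a version of) the Wiener integral `∫_0^T g dB`: the limit in `L²(P)` of elementary
integrals of step functions that converge to `g` in `L²((0, T])`. -/
def IsWienerIntegral {Ω : Type*} [MeasurableSpace Ω] (P : Measure Ω) (B : ℝ≥0 → Ω → ℝ)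
    (g : ℝ → ℝ) (T : ℝ≥0) (J : Ω → ℝ) : Prop :=
  MemLp J 2 P ∧ ∀ ε : ℝ, 0 < ε → ∃ s : StepData T,
    eLpNorm (fun u => s.toFun u - g u) 2 (volume.restrict (Set.Ioc (0 : ℝ) (T : ℝ)))
      ≤ ENNReal.ofReal ε ∧
    eLpNorm (fun ω => s.integral B ω - J ω) 2 P ≤ ENNReal.ofReal ε

open Classical in
/-- The Wiener integral `∫_0^T g dB` (a version of it; it is unique up to a null set, and it
exists when `B` is a Brownian motion and `g` is square integrable on `(0, T]`). -/
def wienerIntegral {Ω : Type*} [MeasurableSpace Ω] (P : Measure Ω) (B : ℝ≥0 → Ω → ℝ)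
    (g : ℝ → ℝ) (T : ℝ≥0) : Ω → ℝ :=
  if h : ∃ J : Ω → ℝ, IsWienerIntegral P B g T J then Classical.choose h else 0

/-! ### Random input and the solution -/

/-- Indices `(j, l, m)` of the real random coefficients: `j = 0` (first kind) with `0 ≤ m ≤ l`, or
`j = 1` (second kind) with `1 ≤ m ≤ l`. -/
def CoeffIndex : Type :=
  {p : Fin 2 × ℕ × ℕ // p.2.2 ≤ p.2.1 ∧ (p.1 = 1 → 1 ≤ p.2.2)}

/-- The random input: `Z j l m` are independent standard normal variables, `b j l m` are
independent standard real Brownian motions, and the two families are independent of each other.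
(A Brownian motion is understood here through its law, as a centred Gaussian process with the
covariance `min s t`; continuity of the paths is not needed.)  Nothing is required of `Z` and `b`
outside the index set. -/
structure IsRandomInput {Ω : Type*} [MeasurableSpace Ω] (P : Measure Ω)
    (Z : Fin 2 → ℕ → ℕ → Ω → ℝ) (b : Fin 2 → ℕ → ℕ → ℝ≥0 → Ω → ℝ) : Prop where
  measurable_Z : ∀ i : CoeffIndex, Measurable (Z i.1.1 i.1.2.1 i.1.2.2)
  law_Z : ∀ i : CoeffIndex, HasLaw (Z i.1.1 i.1.2.1 i.1.2.2) (gaussianReal 0 1) P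
  indep_Z : iIndepFun (fun i : CoeffIndex => Z i.1.1 i.1.2.1 i.1.2.2) P
  measurable_b : ∀ (i : CoeffIndex) (t : ℝ≥0), Measurable (b i.1.1 i.1.2.1 i.1.2.2 t)
  brownian_b : ∀ i : CoeffIndex, IsPreBrownianReal (b i.1.1 i.1.2.1 i.1.2.2) P
  indep_b : iIndepFun
    (fun (i : CoeffIndex) (ω : Ω) (t : ℝ≥0) => b i.1.1 i.1.2.1 i.1.2.2 t ω) P
  indep_Z_b : IndepFun
    (fun (ω : Ω) (i : CoeffIndex) => Z i.1.1 i.1.2.1 i.1.2.2 ω)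
    (fun (ω : Ω) (i : CoeffIndex) (t : ℝ≥0) => b i.1.1 i.1.2.1 i.1.2.2 t ω) P

/-- `√c · a_{l,0} Y_{l,0}(x) + √(2c) ∑_{m=1}^l (a_{l,m} Re Y_{l,m}(x) + a'_{l,m} Im Y_{l,m}(x))`,
the degree-`l` part of a real random field, with `a = coeff 0` and `a' = coeff 1`. -/
def harmonicPart {Ω : Type*} (c : ℝ) (coeff : Fin 2 → ℕ → Ω → ℝ) (l : ℕ)
    (x : Sphere2) (ω : Ω) : ℝ :=
  Real.sqrt c * coeff 0 0 ω * (sphHarm l 0 x).re +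
    Real.sqrt (2 * c) * ∑ m ∈ Finset.Icc 1 l,
      (coeff 0 m ω * (sphHarm l m x).re + coeff 1 m ω * (sphHarm l m x).im)

/-- Degree-`l` part of the homogeneous solution at time `t`. -/
def homPart {Ω : Type*} (α : ℝ) (C : ℕ → ℝ) (Z : Fin 2 → ℕ → ℕ → Ω → ℝ)
    (l : ℕ) (t : ℝ) (x : Sphere2) (ω : Ω) : ℝ :=
  mittagLeffler α (-(sphEigenvalue l) * t ^ α) * harmonicPart (C l) (fun j => Z j l) l x ω

/-- The stochastic convolution `∫_0^T E_α(-λ_l (T - u)^α) dB(u)`. -/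
def mlIntegral {Ω : Type*} [MeasurableSpace Ω] (P : Measure Ω) (α : ℝ) (l : ℕ)
    (B : ℝ≥0 → Ω → ℝ) (T : ℝ≥0) : Ω → ℝ :=
  wienerIntegral P B (fun u => mittagLeffler α (-(sphEigenvalue l) * ((T : ℝ) - u) ^ α)) T

/-- Degree-`l` part of the inhomogeneous solution at time `t`: zero up to the time `τ` at which
the noise is switched on. -/
def inhomPart {Ω : Type*} [MeasurableSpace Ω] (P : Measure Ω) (α τ : ℝ) (A : ℕ → ℝ)
    (b : Fin 2 → ℕ → ℕ → ℝ≥0 → Ω → ℝ) (l : ℕ) (t : ℝ) (x : Sphere2) (ω : Ω) : ℝ :=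
  if t ≤ τ then 0
  else harmonicPart (A l) (fun j m => mlIntegral P α l (b j l m) (t - τ).toNNReal) l x ω

/-- The truncation `U_L(t)` of the solution at degree `L`. -/
def truncatedSolution {Ω : Type*} [MeasurableSpace Ω] (P : Measure Ω) (α τ : ℝ) (C A : ℕ → ℝ)
    (Z : Fin 2 → ℕ → ℕ → Ω → ℝ) (b : Fin 2 → ℕ → ℕ → ℝ≥0 → Ω → ℝ)
    (L : ℕ) (t : ℝ) (x : Sphere2) (ω : Ω) : ℝ :=
  ∑ l ∈ Finset.range (L + 1), (homPart α C Z l t x ω + inhomPart P α τ A b l t x ω)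

/-- `U` is the random field given by the series
`U(x, t) = ∑_{l ≥ 0} (U^H_l(x, t) + U^I_l(x, t))`, `t > 0`: at every point `x` the series
converges to `U(x, t)` in `L²(P)`. -/
def IsSolutionField {Ω : Type*} [MeasurableSpace Ω] (P : Measure Ω) (α τ : ℝ) (C A : ℕ → ℝ)
    (Z : Fin 2 → ℕ → ℕ → Ω → ℝ) (b : Fin 2 → ℕ → ℕ → ℝ≥0 → Ω → ℝ)
    (U : ℝ → Sphere2 → Ω → ℝ) : Prop :=
  ∀ t : ℝ, 0 < t → ∀ x : Sphere2, MemLp (U t x) 2 P ∧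
    Tendsto (fun L : ℕ =>
      eLpNorm (fun ω => truncatedSolution P α τ C A Z b L t x ω - U t x ω) 2 P) atTop (𝓝 0)

/-! ### Spectra, the constant, Hölder continuity -/

/-- An angular power spectrum that decays algebraically with order `κ`. -/
def DecaysAlgebraically (C : ℕ → ℝ) (κ : ℝ) : Prop :=
  (∀ l, 0 ≤ C l) ∧ ∃ D K : ℝ, 0 < D ∧ 0 < K ∧ C 0 ≤ D ∧
    ∀ l : ℕ, 1 ≤ l → C l ≤ K * (l : ℝ) ^ (-κ)

/-- The `l`-th term, `l ≥ 1`, of the series `∑_{l ≥ 1} l^{1+2β} C_l`, indexed by `l - 1`. -/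
def spectralTerm (β : ℝ) (C : ℕ → ℝ) (k : ℕ) : ℝ :=
  ((k + 1 : ℕ) : ℝ) ^ (1 + 2 * β) * C (k + 1)

/-- `∑_{l ≥ 1} l^{1+2β} C_l`. -/
def spectralMoment (β : ℝ) (C : ℕ → ℝ) : ℝ := ∑' k : ℕ, spectralTerm β C k

/-- The constant in the bound for the variance of the spatial increments at time `t`. -/
def incrementConst (β τ : ℝ) (C A : ℕ → ℝ) (t : ℝ) : ℝ :=
  (2 : ℝ) ^ (4 - β) *
    (if t ≤ τ then spectralMoment β C
      else spectralMoment β C + (t - τ) * spectralMoment β A)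

/-- `f` is locally Hölder continuous of order `γ` for the geodesic distance. -/
def LocallyHolderSphere (f : Sphere2 → ℝ) (γ : ℝ) : Prop :=
  ∀ x₀ : Sphere2, ∃ s ∈ 𝓝 x₀, ∃ K : ℝ, ∀ x ∈ s, ∀ y ∈ s,
    |f x - f y| ≤ K * geodesicDist x y ^ γ

end

/-! Every increment U(x,t) − U(y,t) is an L²-limit of linear combinations of independent Gaussian
coefficients and of elementary Wiener integrals. Independence makes it sub-Gaussian with variance
proxy at most ∑_ℓ (C_ℓ + (t−τ)⁺ A_ℓ) D_ℓ(x,y), where D_ℓ is `sphIncrement`, as soon as |E_α| ≤ 1 on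
the negative half line. Sub-Gaussian bounds pass to L²-limits by Fatou's lemma, so the law of the
limit never has to be identified. Such a bound yields the variance estimate without loss in the
constant, and also all even moments. A chaining argument of Kolmogorov type then produces the Hölder
modification.

Two analytic facts remain.

Geometry: D_ℓ ≤ 2^{4−β} ℓ^{1+2β} d^{2β}, with d the geodesic distance. Up to conjugation and
normalization, the Y_{ℓ,m}(v) are the coefficients of q_v(z)^ℓ, where q_v(z) = a + 2v₃z − āz² and a
= v₁ + iv₂. Infinitesimal rotations act on these coefficients by tridiagonal matrices,
skew-Hermitian for the weights k!(2ℓ−k)!, and their Casimir operator is ℓ(ℓ+1). Along a unit speed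
great circle the coefficient vector therefore keeps its norm and moves with speed at most √(ℓ(ℓ+1))
times that norm. Hence D_ℓ is at most 4(2ℓ+1) and at most (2ℓ+1)ℓ(ℓ+1)d². A geometric mean of the
two bounds gives the claim (`sphIncrement_le`), and summability of ℓ^{1+2β}C_ℓ and ℓ^{1+2β}A_ℓ lets
it be summed over ℓ.

Mittag-Leffler: for α < 1, E_α solves a fractional relaxation equation whose derivative can be
written as a singular integral of increments (`mittagLeffler_neg_mul_eq`). At an extremum these
increments have a sign, and a maximum principle gives 0 < E_α(−x) ≤ 1. -/

noncomputable section

/-! ### A generating function for spherical harmonics -/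

open Polynomial in
/-- The quadratic polynomial `a + 2 v₃ z - ā z²`, `a = v₁ + i v₂`: the pairing of `v` with the
standard parametrization of the null vectors of `ℂ³`. -/
def nullQuadratic (v : EuclideanSpace ℝ (Fin 3)) : Polynomial ℂ :=
  C (⟨v 0, v 1⟩ : ℂ) + C (2 * (v 2 : ℂ)) * X - C (⟨v 0, -v 1⟩ : ℂ) * X ^ 2

/-- The coefficients of the `l`-th power of `nullQuadratic v`: up to normalization, the spherical
harmonics of degree `l`. -/
def harmCoeff (l : ℕ) (v : EuclideanSpace ℝ (Fin 3)) (k : ℕ) : ℂ := (nullQuadratic v ^ l).coeff k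

/-- The weights of the rotation invariant inner product on the coefficients. -/
def harmWeight (l k : ℕ) : ℝ := (k.factorial : ℝ) * ((2 * l - k).factorial : ℝ)

lemma harmWeight_nonneg (l k : ℕ) : 0 ≤ harmWeight l k := by unfold harmWeight; positivity

lemma nullQuadratic_natDegree (v : EuclideanSpace ℝ (Fin 3)) :
    (nullQuadratic v).natDegree ≤ 2 := by
  unfold nullQuadratic; compute_degree

lemma harmCoeff_eq_zero {l k : ℕ} (v : EuclideanSpace ℝ (Fin 3)) (h : 2 * l < k) :
    harmCoeff l v k = 0 := by
  apply Polynomial.coeff_eq_zero_of_natDegree_lt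
  calc _ ≤ l * 2 := Polynomial.natDegree_pow_le_of_le l (nullQuadratic_natDegree v)
    _ < k := by omega

lemma hasDerivAt_coeff_mul {p q : ℝ → Polynomial ℂ} {p' q' : Polynomial ℂ} {t : ℝ}
    (hp : ∀ k, HasDerivAt (fun s => (p s).coeff k) (p'.coeff k) t)
    (hq : ∀ k, HasDerivAt (fun s => (q s).coeff k) (q'.coeff k) t) (k : ℕ) :
    HasDerivAt (fun s => (p s * q s).coeff k) ((p' * q t + p t * q').coeff k) t := by
  simp only [Polynomial.coeff_add, Polynomial.coeff_mul, ← Finset.sum_add_distrib]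
  exact HasDerivAt.fun_sum fun i _ => (hp i.1).mul (hq i.2)

lemma hasDerivAt_coeff_pow {p : ℝ → Polynomial ℂ} {p' : Polynomial ℂ} {t : ℝ}
    (hp : ∀ k, HasDerivAt (fun s => (p s).coeff k) (p'.coeff k) t) (n k : ℕ) :
    HasDerivAt (fun s => (p s ^ n).coeff k) ((n * p t ^ (n - 1) * p').coeff k) t := by
  induction n generalizing k with
  | zero => simpa using hasDerivAt_const _ _
  | succ n ih =>
    simp only [pow_succ]
    convert hasDerivAt_coeff_mul ih hp k using 2
    rcases n with _ | n
    · simp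
    · simp only [Nat.add_sub_cancel]; push_cast; ring

/-- Infinitesimal rotation with angular velocity `x × v`, acting on `nullQuadratic`. -/
lemma nullQuadratic_rotate (x v : EuclideanSpace ℝ (Fin 3))
    (hx : x 0 ^ 2 + x 1 ^ 2 + x 2 ^ 2 = 1) (hxv : x 0 * v 0 + x 1 * v 1 + x 2 * v 2 = 0)
    (a b c : ℝ) (ha : a = x 1 * v 2 - x 2 * v 1) (hb : b = x 2 * v 0 - x 0 * v 2)
    (hc : c = x 0 * v 1 - x 1 * v 0) :
    nullQuadratic v =
      (Polynomial.C (-(Complex.I / 2) * (a + b * Complex.I)) -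
        Polynomial.C (Complex.I * c) * Polynomial.X +
        Polynomial.C (Complex.I / 2 * (a - b * Complex.I)) * Polynomial.X ^ 2) *
          Polynomial.derivative (nullQuadratic x) +
      (Polynomial.C (Complex.I * c) -
        Polynomial.C (Complex.I * (a - b * Complex.I)) * Polynomial.X) * nullQuadratic x := by
  -- With ω = (a, b, c) = x × v, |x| = 1 and x ⊥ v, the double cross product gives v = ω × x.
  have h0 : v 0 = b * x 2 - c * x 1 := by
    subst ha hb hc; linear_combination (-(v 0)) * hx + x 0 * hxv
  have h1 : v 1 = c * x 0 - a * x 2 := by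
    subst ha hb hc; linear_combination (-(v 1)) * hx + x 1 * hxv
  have h2 : v 2 = a * x 1 - b * x 0 := by
    subst ha hb hc; linear_combination (-(v 2)) * hx + x 2 * hxv
  have e1 : (⟨v 0, v 1⟩ : ℂ) = v 0 + v 1 * Complex.I := by
    apply Complex.ext <;> simp
  have e2 : (⟨v 0, -v 1⟩ : ℂ) = v 0 - v 1 * Complex.I := by
    apply Complex.ext <;> simp
  have e3 : (⟨x 0, x 1⟩ : ℂ) = x 0 + x 1 * Complex.I := by
    apply Complex.ext <;> simp
  have e4 : (⟨x 0, -x 1⟩ : ℂ) = x 0 - x 1 * Complex.I := by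
    apply Complex.ext <;> simp
  unfold nullQuadratic
  rw [e1, e2, e3, e4, h0, h1, h2]
  have hI : (Polynomial.C Complex.I : Polynomial ℂ) ^ 2 = -1 := by
    rw [← Polynomial.C_pow, Complex.I_sq]; simp
  -- Everything is expressed through J = i/2. After generalization the claim is a polynomial
  -- identity modulo the single relation (2J)² = −1.
  have h2' : (Polynomial.C Complex.I : Polynomial ℂ) = 2 * Polynomial.C (Complex.I / 2) := by
    rw [show (2 : Polynomial ℂ) = Polynomial.C 2 from rfl, ← Polynomial.C_mul]; congr 1; ring
  simp only [Polynomial.derivative_add, Polynomial.derivative_sub, Polynomial.derivative_mul,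
    Polynomial.derivative_C, Polynomial.derivative_X, Polynomial.derivative_X_pow]
  push_cast
  simp only [map_mul, map_add, map_sub, map_neg, Polynomial.C_ofNat]
  rw [h2'] at hI ⊢
  generalize Polynomial.C (Complex.I / 2) = J at hI ⊢
  generalize Polynomial.C (a : ℂ) = a at hI ⊢
  generalize Polynomial.C (b : ℂ) = b at hI ⊢
  generalize Polynomial.C (c : ℂ) = c at hI ⊢
  generalize Polynomial.C (x 0 : ℂ) = x0 at hI ⊢
  generalize Polynomial.C (x 1 : ℂ) = x1 at hI ⊢
  generalize Polynomial.C (x 2 : ℂ) = x2 at hI ⊢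
  grind

/-! ### Infinitesimal rotations of the coefficients and the Casimir bound -/

/-- The coefficients shifted by one index. -/
def harmCoeffPrev (l : ℕ) (v : EuclideanSpace ℝ (Fin 3)) (k : ℕ) : ℂ :=
  if k = 0 then 0 else harmCoeff l v (k - 1)

/-- The action of the infinitesimal rotation with angular velocity `(a, b, c)` on the
coefficients. -/
def harmRotate (l : ℕ) (a b c : ℝ) (x : EuclideanSpace ℝ (Fin 3)) (k : ℕ) : ℂ :=
  -(Complex.I / 2) * (a + b * Complex.I) * ((k + 1) * harmCoeff l x (k + 1)) +
    Complex.I * c * ((l - k) * harmCoeff l x k) -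
    (Complex.I / 2) * (a - b * Complex.I) * ((2 * l - k + 1) * harmCoeffPrev l x k)

/-- Multiplying `nullQuadratic_rotate` by ℓ q^{ℓ−1} and using (q^ℓ)' = ℓ q^{ℓ−1} q' gives a
first-order differential operator in z applied to q^ℓ. Since z and d/dz shift the index, it is
tridiagonal in the coefficients. -/
lemma coeff_rotate (x v : EuclideanSpace ℝ (Fin 3))
    (hx : x 0 ^ 2 + x 1 ^ 2 + x 2 ^ 2 = 1) (hxv : x 0 * v 0 + x 1 * v 1 + x 2 * v 2 = 0)
    (a b c : ℝ) (ha : a = x 1 * v 2 - x 2 * v 1) (hb : b = x 2 * v 0 - x 0 * v 2)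
    (hc : c = x 0 * v 1 - x 1 * v 0) (l k : ℕ) :
    ((l : Polynomial ℂ) * nullQuadratic x ^ (l - 1) * nullQuadratic v).coeff k =
      harmRotate l a b c x k := by
  have key : (l : Polynomial ℂ) * nullQuadratic x ^ (l - 1) * nullQuadratic v =
      Polynomial.C (-(Complex.I / 2) * (a + b * Complex.I)) *
          Polynomial.derivative (nullQuadratic x ^ l) -
        Polynomial.C (Complex.I * c) * (Polynomial.derivative (nullQuadratic x ^ l) *
          Polynomial.X) +
        Polynomial.C (Complex.I / 2 * (a - b * Complex.I)) *
          (Polynomial.derivative (nullQuadratic x ^ l) * Polynomial.X * Polynomial.X) +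
        Polynomial.C (Complex.I * c * l) * nullQuadratic x ^ l -
        Polynomial.C (Complex.I * (a - b * Complex.I) * l) *
          (nullQuadratic x ^ l * Polynomial.X) := by
    rw [nullQuadratic_rotate x v hx hxv a b c ha hb hc, Polynomial.derivative_pow]
    rcases l with _ | l
    · simp
    · simp only [Nat.add_sub_cancel, pow_succ, Polynomial.C_mul, Polynomial.C_eq_natCast]
      ring
  rw [key]
  unfold harmRotate harmCoeffPrev
  simp only [Polynomial.coeff_add, Polynomial.coeff_sub, Polynomial.coeff_C_mul]
  rcases k with _ | _ | k
  · simp [Polynomial.coeff_derivative, harmCoeff]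
    ring
  · simp [Polynomial.coeff_derivative, harmCoeff, Polynomial.coeff_mul_X]
    ring
  · simp [Polynomial.coeff_derivative, harmCoeff, Polynomial.coeff_mul_X]
    ring

/-- The weights w_k = k!(2ℓ−k)! satisfy (k+1) w_k = (2ℓ−k) w_{k+1}, so a shift of the index trades
one factor for the other. -/
lemma sum_harmWeight_succ (l : ℕ) (p : ℕ → ℝ) (hp : ∀ k, 2 * l < k → p k = 0) :
    ∑ k ∈ Finset.range (2 * l + 1), harmWeight l k * ((k + 1) ^ 2 * p (k + 1)) =
      ∑ k ∈ Finset.range (2 * l + 1), harmWeight l k * (k * (2 * l - k + 1) * p k) := by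
  rw [Finset.sum_range_succ, hp _ (Nat.lt_succ_self _), Finset.sum_range_succ']
  simp only [mul_zero, add_zero, Nat.cast_zero, zero_mul]
  refine Finset.sum_congr rfl fun k hk => ?_
  have hk' := Finset.mem_range.1 hk
  obtain ⟨j, hj⟩ : ∃ j, 2 * l = k + 1 + j := ⟨2 * l - (k + 1), by omega⟩
  have e1 : 2 * l - k = j + 1 := by omega
  have e2 : 2 * l - (k + 1) = j := by omega
  have e3 : (2 * l : ℝ) = k + 1 + j := by exact_mod_cast hj
  unfold harmWeight
  rw [e1, e2, e3, Nat.factorial_succ, Nat.factorial_succ]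
  push_cast; ring

lemma sum_harmWeight_prev (l : ℕ) (p : ℕ → ℝ) :
    ∑ k ∈ Finset.range (2 * l + 1), harmWeight l k *
        ((2 * l - k + 1) ^ 2 * (if k = 0 then 0 else p (k - 1))) =
      ∑ k ∈ Finset.range (2 * l + 1), harmWeight l k * ((k + 1) * (2 * l - k) * p k) := by
  rw [Finset.sum_range_succ', Finset.sum_range_succ]
  simp only [if_pos, mul_zero, add_zero, Nat.cast_mul, Nat.cast_ofNat, sub_self, zero_mul]
  refine Finset.sum_congr rfl fun k hk => ?_
  have hk' := Finset.mem_range.1 hk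
  obtain ⟨j, hj⟩ : ∃ j, 2 * l = k + 1 + j := ⟨2 * l - (k + 1), by omega⟩
  have e1 : 2 * l - k = j + 1 := by omega
  have e2 : 2 * l - (k + 1) = j := by omega
  have e3 : (2 * l : ℝ) = k + 1 + j := by exact_mod_cast hj
  unfold harmWeight
  rw [e1, e2, e3, Nat.factorial_succ, Nat.factorial_succ]
  simp
  ring

/-- The vector is a·L₁ + b·L₂ + c·L₃ with L₁ = −(i/2)(R+S), L₂ = (R−S)/2 and L₃ = iT. Cauchy–Schwarz
bounds it by |L₁|² + |L₂|² + |L₃|², which the parallelogram law evaluates. -/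
lemma norm_sq_infinitesimal_rotation_le (a b c : ℝ) (R S T : ℂ) (h : a ^ 2 + b ^ 2 + c ^ 2 = 1) :
    ‖-(Complex.I / 2) * (a + b * Complex.I) * R + Complex.I * c * T -
      (Complex.I / 2) * (a - b * Complex.I) * S‖ ^ 2 ≤ (‖R‖ ^ 2 + ‖S‖ ^ 2) / 2 + ‖T‖ ^ 2 := by
  have e : -(Complex.I / 2) * (a + b * Complex.I) * R + Complex.I * c * T -
      (Complex.I / 2) * (a - b * Complex.I) * S =
      a * (-(Complex.I / 2) * (R + S)) + b * ((R - S) / 2) + c * (Complex.I * T) := by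
    linear_combination (b * R / 2 * (-1) + b * S / 2) * Complex.I_sq
  have hn : ∀ z : ℂ, ‖z‖ ^ 2 = z.re ^ 2 + z.im ^ 2 := fun z => by
    rw [Complex.sq_norm, Complex.normSq_apply]; ring
  rw [e]
  have key : ∀ u v w : ℝ, (a * u + b * v + c * w) ^ 2 ≤ u ^ 2 + v ^ 2 + w ^ 2 := by
    intro u v w
    have : u ^ 2 + v ^ 2 + w ^ 2 - (a * u + b * v + c * w) ^ 2 =
      (a * v - b * u) ^ 2 + (a * w - c * u) ^ 2 + (b * w - c * v) ^ 2 := by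
      linear_combination (-(u ^ 2 + v ^ 2 + w ^ 2)) * h
    nlinarith [sq_nonneg (a * v - b * u), sq_nonneg (a * w - c * u), sq_nonneg (b * w - c * v)]
  have h1 := key ((R.im + S.im) / 2) ((R.re - S.re) / 2) (-T.im)
  have h2 := key (-(R.re + S.re) / 2) ((R.im - S.im) / 2) T.re
  simp only [hn]
  simp
  ring_nf at h1 h2 ⊢
  linarith

/-- One rotation generator is dominated by the Casimir operator. After the two index shifts the
factor of w_k|p_k|² is ½[k(2ℓ−k+1) + (k+1)(2ℓ−k)] + (ℓ−k)² = ℓ(ℓ+1), independent of k. -/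
lemma sum_harmRotate_le (l : ℕ) (a b c : ℝ) (x : EuclideanSpace ℝ (Fin 3))
    (h : a ^ 2 + b ^ 2 + c ^ 2 = 1) :
    ∑ k ∈ Finset.range (2 * l + 1), harmWeight l k * ‖harmRotate l a b c x k‖ ^ 2 ≤
      l * (l + 1) * ∑ k ∈ Finset.range (2 * l + 1), harmWeight l k * ‖harmCoeff l x k‖ ^ 2 := by
  have h1 := sum_harmWeight_succ l (fun k => ‖harmCoeff l x k‖ ^ 2) fun k hk => by
    simp [harmCoeff_eq_zero x hk]
  have h2 := sum_harmWeight_prev l (fun k => ‖harmCoeff l x k‖ ^ 2)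
  calc _ ≤ ∑ k ∈ Finset.range (2 * l + 1), (1 / 2 * (harmWeight l k * ((k + 1) ^ 2 *
          ‖harmCoeff l x (k + 1)‖ ^ 2)) +
          1 / 2 * (harmWeight l k * ((2 * l - k + 1) ^ 2 *
            (if k = 0 then 0 else ‖harmCoeff l x (k - 1)‖ ^ 2))) +
          harmWeight l k * ((l - k) ^ 2 * ‖harmCoeff l x k‖ ^ 2)) := by
        refine Finset.sum_le_sum fun k hk => ?_
        have := mul_le_mul_of_nonneg_left (norm_sq_infinitesimal_rotation_le a b c
          ((k + 1) * harmCoeff l x (k + 1)) ((2 * l - k + 1) * harmCoeffPrev l x k)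
          ((l - k) * harmCoeff l x k) h) (harmWeight_nonneg l k)
        unfold harmRotate
        refine this.trans (le_of_eq ?_)
        have c1 : ‖((k : ℂ) + 1)‖ = k + 1 := by exact_mod_cast Complex.norm_natCast (k + 1)
        have c2 : ‖((2 : ℂ) * l - k + 1)‖ ^ 2 = ((2 : ℝ) * l - k + 1) ^ 2 := by
          rw [show ((2 : ℂ) * l - k + 1) = (((2 : ℝ) * l - k + 1 : ℝ) : ℂ) by push_cast; ring,
            Complex.norm_real, Real.norm_eq_abs, sq_abs]
        have c3 : ‖((l : ℂ) - k)‖ ^ 2 = ((l : ℝ) - k) ^ 2 := by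
          rw [show ((l : ℂ) - k) = (((l : ℝ) - k : ℝ) : ℂ) by push_cast; ring,
            Complex.norm_real, Real.norm_eq_abs, sq_abs]
        have c4 : ‖harmCoeffPrev l x k‖ ^ 2 =
            if k = 0 then 0 else ‖harmCoeff l x (k - 1)‖ ^ 2 := by
          unfold harmCoeffPrev; split_ifs <;> simp
        simp only [norm_mul, mul_pow, c1, c2, c3, c4]
        ring
    _ = _ := by
        rw [Finset.sum_add_distrib, Finset.sum_add_distrib, ← Finset.mul_sum, ← Finset.mul_sum,
          h1, h2, Finset.mul_sum, Finset.mul_sum, Finset.mul_sum, ← Finset.sum_add_distrib,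
          ← Finset.sum_add_distrib]
        refine Finset.sum_congr rfl fun k _ => ?_
        ring

/-- The generators are skew-Hermitian for the weighted inner product, so rotations preserve the
weighted norm. -/
lemma sum_re_harmRotate (l : ℕ) (a b c : ℝ) (x : EuclideanSpace ℝ (Fin 3)) :
    ∑ k ∈ Finset.range (2 * l + 1), harmWeight l k *
      ((harmRotate l a b c x k) * starRingEnd ℂ (harmCoeff l x k)).re = 0 := by
  set p := harmCoeff l x
  -- Here `g k` is the coupling of the indices k and k+1. The diagonal term is purely imaginary, and
  -- the coupling to the lower neighbour contributes −`g (k - 1)`, so the sum telescopes. The last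
  -- term `g (2 * l)` contains the vanishing coefficient 2ℓ+1.
  set g : ℕ → ℝ := fun k => (k + 1).factorial * (2 * l - k).factorial *
    (-(Complex.I / 2) * (a + b * Complex.I) * (p (k + 1) * starRingEnd ℂ (p k))).re
  set g' : ℕ → ℝ := fun k => if k = 0 then 0 else g (k - 1)
  have hterm : ∀ k ∈ Finset.range (2 * l + 1), harmWeight l k *
      ((harmRotate l a b c x k) * starRingEnd ℂ (p k)).re = g k - g' k := by
    intro k hk
    have hk' := Finset.mem_range.1 hk
    have e : (harmRotate l a b c x k * starRingEnd ℂ (p k)).re =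
        (k + 1) * (-(Complex.I / 2) * (a + b * Complex.I) * (p (k + 1) * starRingEnd ℂ (p k))).re -
        (2 * l - k + 1) * ((Complex.I / 2) * (a - b * Complex.I) * (harmCoeffPrev l x k *
          starRingEnd ℂ (p k))).re := by
      have : harmRotate l a b c x k * starRingEnd ℂ (p k) =
        ((k + 1 : ℝ) : ℂ) *
          (-(Complex.I / 2) * (a + b * Complex.I) * (p (k + 1) * starRingEnd ℂ (p k))) -
        ((2 * l - k + 1 : ℝ) : ℂ) * ((Complex.I / 2) * (a - b * Complex.I) *
          (harmCoeffPrev l x k * starRingEnd ℂ (p k))) +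
        Complex.I * ((c * (l - k) * Complex.normSq (p k) : ℝ) : ℂ) := by
        have hns := Complex.mul_conj (p k)
        push_cast
        rw [← hns]
        unfold harmRotate
        ring
      rw [this]
      simp [-Complex.ofReal_mul, -Complex.ofReal_add, -Complex.ofReal_sub]
      ring
    rw [e]
    rcases k with _ | k
    · simp [g, g', harmCoeffPrev, harmWeight]
    · have e1 : 2 * l - k = 2 * l - (k + 1) + 1 := by omega
      have e2 : (2 * l : ℝ) - (k + 1 : ℕ) + 1 = ((2 * l - (k + 1) + 1 : ℕ) : ℝ) := by
        rw [← e1, Nat.cast_sub (by omega)]; push_cast; ring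
      have e3 : ((Complex.I / 2) * (a - b * Complex.I) * (p k * starRingEnd ℂ (p (k + 1)))).re =
          (-(Complex.I / 2) * (a + b * Complex.I) * (p (k + 1) * starRingEnd ℂ (p k))).re := by
        rw [← Complex.conj_re]
        congr 1
        simp only [map_mul, map_sub, map_div₀, Complex.conj_I, Complex.conj_ofReal,
          Complex.conj_conj, map_ofNat]
        ring
      simp only [g, g', harmCoeffPrev, harmWeight, Nat.succ_ne_zero, if_false, Nat.add_sub_cancel]
      rw [e2, e3, e1, Nat.factorial_succ (2 * l - (k + 1)), Nat.factorial_succ (k + 1)]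
      push_cast
      ring
  rw [Finset.sum_congr rfl hterm, Finset.sum_sub_distrib, Finset.sum_range_succ,
    Finset.sum_range_succ' g']
  have h0 : g (2 * l) = 0 := by
    have : p (2 * l + 1) = 0 := harmCoeff_eq_zero x (Nat.lt_succ_self _)
    simp [g, this]
  simp [g', h0]

/-- The coefficients as a vector of a Hermitian space, normalized by the weights. -/
def harmVector (l : ℕ) (v : EuclideanSpace ℝ (Fin 3)) : EuclideanSpace ℂ (Fin (2 * l + 1)) :=
  WithLp.toLp 2 fun k => (Real.sqrt (harmWeight l k) : ℂ) * harmCoeff l v k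

lemma norm_sq_toLp_weighted (l : ℕ) (f : ℕ → ℂ) :
    ‖(WithLp.toLp 2 fun k : Fin (2 * l + 1) => (Real.sqrt (harmWeight l k) : ℂ) * f k :
      EuclideanSpace ℂ (Fin (2 * l + 1)))‖ ^ 2 =
      ∑ k ∈ Finset.range (2 * l + 1), harmWeight l k * ‖f k‖ ^ 2 := by
  rw [EuclideanSpace.norm_sq_eq, Finset.sum_range]
  refine Finset.sum_congr rfl fun k _ => ?_
  simp only [norm_mul, mul_pow, Complex.norm_real, Real.norm_eq_abs, sq_abs,
    Real.sq_sqrt (harmWeight_nonneg l k)]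

lemma norm_sq_harmVector (l : ℕ) (v : EuclideanSpace ℝ (Fin 3)) :
    ‖harmVector l v‖ ^ 2 =
      ∑ k ∈ Finset.range (2 * l + 1), harmWeight l k * ‖harmCoeff l v k‖ ^ 2 :=
  norm_sq_toLp_weighted l _

/-! ### Motion of the coefficients along great circles -/

/-- The unit speed great circle through `x` in the direction `e`. -/
def greatCircle (x e : EuclideanSpace ℝ (Fin 3)) (t : ℝ) : EuclideanSpace ℝ (Fin 3) :=
  Real.cos t • x + Real.sin t • e

lemma greatCircle_apply (x e : EuclideanSpace ℝ (Fin 3)) (t : ℝ) (i : Fin 3) :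
    greatCircle x e t i = Real.cos t * x i + Real.sin t * e i := by
  simp [greatCircle]

lemma hasDerivAt_coeff_nullQuadratic {v : ℝ → EuclideanSpace ℝ (Fin 3)}
    {v' : EuclideanSpace ℝ (Fin 3)} {t : ℝ} (h : ∀ i, HasDerivAt (fun s => v s i) (v' i) t)
    (k : ℕ) :
    HasDerivAt (fun s => (nullQuadratic (v s)).coeff k) ((nullQuadratic v').coeff k) t := by
  have e : ∀ w : EuclideanSpace ℝ (Fin 3), (nullQuadratic w).coeff k =
      ((w 0 : ℂ) + w 1 * Complex.I) * (if k = 0 then 1 else 0) +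
      (w 2 : ℂ) * (if k = 1 then 2 else 0) -
      ((w 0 : ℂ) - w 1 * Complex.I) * (if k = 2 then 1 else 0) := by
    intro w
    have e1 : (⟨w 0, w 1⟩ : ℂ) = w 0 + w 1 * Complex.I := by apply Complex.ext <;> simp
    have e2 : (⟨w 0, -w 1⟩ : ℂ) = w 0 - w 1 * Complex.I := by apply Complex.ext <;> simp
    unfold nullQuadratic
    rw [e1, e2, Polynomial.coeff_sub, Polynomial.coeff_add, Polynomial.coeff_C,
      Polynomial.coeff_C_mul, Polynomial.coeff_X, Polynomial.coeff_C_mul, Polynomial.coeff_X_pow]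
    rcases k with _ | _ | _ | k <;> simp [mul_comm]
  simp only [e]
  have h0 := (h 0).ofReal_comp
  have h1 := (h 1).ofReal_comp
  have h2 := (h 2).ofReal_comp
  exact (((h0.add (h1.mul_const _)).mul_const _).add (h2.mul_const _)).sub
    ((h0.sub (h1.mul_const _)).mul_const _)

/-- The great circle is the orbit of x under rotation with the constant angular velocity x × e. -/
lemma hasDerivAt_harmCoeff_greatCircle {x e : EuclideanSpace ℝ (Fin 3)}
    (hx : x 0 ^ 2 + x 1 ^ 2 + x 2 ^ 2 = 1) (he : e 0 ^ 2 + e 1 ^ 2 + e 2 ^ 2 = 1)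
    (hxe : x 0 * e 0 + x 1 * e 1 + x 2 * e 2 = 0) (l k : ℕ) (t : ℝ) :
    HasDerivAt (fun s => harmCoeff l (greatCircle x e s) k)
      (harmRotate l (x 1 * e 2 - x 2 * e 1) (x 2 * e 0 - x 0 * e 2) (x 0 * e 1 - x 1 * e 0)
        (greatCircle x e t) k) t := by
  set v' : EuclideanSpace ℝ (Fin 3) := WithLp.toLp 2 fun i =>
    -Real.sin t * x i + Real.cos t * e i with hv'
  have hd : ∀ i, HasDerivAt (fun s => greatCircle x e s i) (v' i) t := by
    intro i
    simp only [greatCircle_apply, hv']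
    exact ((Real.hasDerivAt_cos t).mul_const _).add ((Real.hasDerivAt_sin t).mul_const _)
  have key := hasDerivAt_coeff_pow (hasDerivAt_coeff_nullQuadratic hd) l k
  have hcs := Real.sin_sq_add_cos_sq t
  rw [coeff_rotate (greatCircle x e t) v' _ _ (x 1 * e 2 - x 2 * e 1) (x 2 * e 0 - x 0 * e 2)
    (x 0 * e 1 - x 1 * e 0)] at key
  · exact key
  all_goals simp only [greatCircle_apply, hv']
  · linear_combination (-(x 1 * e 2) + x 2 * e 1) * hcs
  · linear_combination (-(x 2 * e 0) + x 0 * e 2) * hcs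
  · linear_combination (-(x 0 * e 1) + x 1 * e 0) * hcs
  · linear_combination (Real.cos t ^ 2) * hx + Real.sin t ^ 2 * he +
      2 * Real.cos t * Real.sin t * hxe + hcs
  · linear_combination (-(Real.cos t * Real.sin t)) * hx + Real.cos t * Real.sin t * he +
      (Real.cos t ^ 2 - Real.sin t ^ 2) * hxe

lemma norm_sq_harmVector_greatCircle {x e : EuclideanSpace ℝ (Fin 3)}
    (hx : x 0 ^ 2 + x 1 ^ 2 + x 2 ^ 2 = 1) (he : e 0 ^ 2 + e 1 ^ 2 + e 2 ^ 2 = 1)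
    (hxe : x 0 * e 0 + x 1 * e 1 + x 2 * e 2 = 0) (l : ℕ) (t : ℝ) :
    ‖harmVector l (greatCircle x e t)‖ ^ 2 = ‖harmVector l x‖ ^ 2 := by
  have h : ∀ s, HasDerivAt (fun s => ‖harmVector l (greatCircle x e s)‖ ^ 2) 0 s := by
    intro s
    simp only [norm_sq_harmVector]
    have : (0 : ℝ) = ∑ k ∈ Finset.range (2 * l + 1), harmWeight l k * (2 *
      ((harmRotate l (x 1 * e 2 - x 2 * e 1) (x 2 * e 0 - x 0 * e 2) (x 0 * e 1 - x 1 * e 0)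
        (greatCircle x e s) k) * starRingEnd ℂ (harmCoeff l (greatCircle x e s) k)).re) := by
      have := sum_re_harmRotate l (x 1 * e 2 - x 2 * e 1) (x 2 * e 0 - x 0 * e 2)
        (x 0 * e 1 - x 1 * e 0) (greatCircle x e s)
      simp only [mul_left_comm _ (2 : ℝ), ← Finset.mul_sum, this, mul_zero]
    rw [this]
    refine HasDerivAt.fun_sum fun k _ => HasDerivAt.const_mul _ ?_
    have := (hasDerivAt_harmCoeff_greatCircle hx he hxe l k s).norm_sq
    rwa [Complex.inner] at this
  have := is_const_of_deriv_eq_zero (fun s => (h s).differentiableAt) (fun s => (h s).deriv) t 0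
  simpa [greatCircle] using this

/-- Mean value inequality: the speed is bounded by the Casimir estimate at the current point, whose
norm is that of the starting point. -/
lemma norm_harmVector_greatCircle_sub_le {x e : EuclideanSpace ℝ (Fin 3)}
    (hx : x 0 ^ 2 + x 1 ^ 2 + x 2 ^ 2 = 1) (he : e 0 ^ 2 + e 1 ^ 2 + e 2 ^ 2 = 1)
    (hxe : x 0 * e 0 + x 1 * e 1 + x 2 * e 2 = 0) (l : ℕ) {t : ℝ} (ht : 0 ≤ t) :
    ‖harmVector l (greatCircle x e t) - harmVector l x‖ ≤
      Real.sqrt (l * (l + 1)) * ‖harmVector l x‖ * t := by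
  set a := x 1 * e 2 - x 2 * e 1
  set b := x 2 * e 0 - x 0 * e 2
  set c := x 0 * e 1 - x 1 * e 0
  have habc : a ^ 2 + b ^ 2 + c ^ 2 = 1 := by
    linear_combination he + (e 0 ^ 2 + e 1 ^ 2 + e 2 ^ 2) * hx -
      (x 0 * e 0 + x 1 * e 1 + x 2 * e 2) * hxe
  set f' : ℝ → EuclideanSpace ℂ (Fin (2 * l + 1)) := fun s => WithLp.toLp 2 fun k =>
    (Real.sqrt (harmWeight l k) : ℂ) * harmRotate l a b c (greatCircle x e s) k
  have hd : ∀ s, HasDerivAt (fun s => harmVector l (greatCircle x e s)) (f' s) s := by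
    intro s
    have h1 : HasDerivAt (fun s => fun k : Fin (2 * l + 1) =>
        (Real.sqrt (harmWeight l k) : ℂ) * harmCoeff l (greatCircle x e s) k)
        (fun k => (Real.sqrt (harmWeight l k) : ℂ) * harmRotate l a b c (greatCircle x e s) k)
        s := by
      rw [hasDerivAt_pi]
      exact fun k => (hasDerivAt_harmCoeff_greatCircle hx he hxe l k s).const_mul _
    exact (PiLp.continuousLinearEquiv 2 ℝ
      (fun _ : Fin (2 * l + 1) => ℂ)).symm.hasFDerivAt.comp_hasDerivAt s h1
  have hb : ∀ s, ‖f' s‖ ≤ Real.sqrt (l * (l + 1)) * ‖harmVector l x‖ := by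
    intro s
    rw [← abs_of_nonneg (norm_nonneg (f' s)), ← abs_of_nonneg (show
      0 ≤ Real.sqrt (l * (l + 1)) * ‖harmVector l x‖ by positivity)]
    apply sq_le_sq.1
    rw [mul_pow, Real.sq_sqrt (by positivity), norm_sq_toLp_weighted,
      ← norm_sq_harmVector_greatCircle hx he hxe l s, norm_sq_harmVector]
    exact sum_harmRotate_le l a b c _ habc
  have := norm_image_sub_le_of_norm_deriv_le_segment' (a := 0) (b := t)
    (fun s _ => (hd s).hasDerivWithinAt) (fun s _ => hb s) t (Set.right_mem_Icc.2 ht)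
  simpa [greatCircle] using this

/-! ### Points of the sphere joined by great circles -/

lemma sphere_sq (x : Sphere2) : x.1 0 ^ 2 + x.1 1 ^ 2 + x.1 2 ^ 2 = 1 := by
  have h : ‖x.1‖ ^ 2 = 1 := by rw [norm_eq_of_mem_sphere]; norm_num
  rw [EuclideanSpace.norm_sq_eq, Fin.sum_univ_three] at h
  simpa using h

lemma sphere_inner (x y : Sphere2) :
    inner ℝ x.1 y.1 = x.1 0 * y.1 0 + x.1 1 * y.1 1 + x.1 2 * y.1 2 := by
  rw [PiLp.inner_apply, Fin.sum_univ_three]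
  simp [mul_comm]

lemma abs_sphere_inner_le (x y : Sphere2) : |inner ℝ x.1 y.1| ≤ 1 := by
  have := abs_real_inner_le_norm x.1 y.1
  simpa using this

lemma exists_unit_orthogonal (x : EuclideanSpace ℝ (Fin 3)) :
    ∃ e : EuclideanSpace ℝ (Fin 3),
      e 0 ^ 2 + e 1 ^ 2 + e 2 ^ 2 = 1 ∧ x 0 * e 0 + x 1 * e 1 + x 2 * e 2 = 0 := by
  by_cases h : x 0 ^ 2 + x 1 ^ 2 = 0
  · have h0 : x 0 = 0 := by nlinarith [sq_nonneg (x 0), sq_nonneg (x 1)]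
    exact ⟨!₂[1, 0, 0], by simp, by simp [h0]⟩
  · have hpos : 0 < x 0 ^ 2 + x 1 ^ 2 := lt_of_le_of_ne (by positivity) (Ne.symm h)
    have hs := Real.sq_sqrt hpos.le
    have hs0 := (Real.sqrt_pos.2 hpos).ne'
    set r := Real.sqrt (x 0 ^ 2 + x 1 ^ 2)
    refine ⟨!₂[-x 1 / r, x 0 / r, 0], ?_, ?_⟩
    · simp only [Matrix.cons_val]
      field_simp
      linarith
    · simp only [Matrix.cons_val]
      ring

/-- Any two points of the sphere are joined by a great circle arc. -/
lemma exists_greatCircle (x y : Sphere2) : ∃ e : EuclideanSpace ℝ (Fin 3),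
    e 0 ^ 2 + e 1 ^ 2 + e 2 ^ 2 = 1 ∧ x.1 0 * e 0 + x.1 1 * e 1 + x.1 2 * e 2 = 0 ∧
      y.1 = greatCircle x.1 e (geodesicDist x y) := by
  have hx := sphere_sq x
  have hy := sphere_sq y
  have hs1 := abs_le.1 (abs_sphere_inner_le x y)
  have hcos : Real.cos (geodesicDist x y) = inner ℝ x.1 y.1 := Real.cos_arccos hs1.1 hs1.2
  have hsin : Real.sin (geodesicDist x y) = Real.sqrt (1 - (inner ℝ x.1 y.1) ^ 2) :=
    Real.sin_arccos _
  have hin := sphere_inner x y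
  set s : ℝ := inner ℝ x.1 y.1
  -- If y = ±x, the sine of the distance vanishes and any orthogonal direction serves. Otherwise e
  -- is the normalized component of y orthogonal to x.
  by_cases h : 1 - s ^ 2 = 0
  · obtain ⟨e, he, hxe⟩ := exists_unit_orthogonal x.1
    refine ⟨e, he, hxe, ?_⟩
    have hsum : (y.1 0 - s * x.1 0) ^ 2 + (y.1 1 - s * x.1 1) ^ 2 + (y.1 2 - s * x.1 2) ^ 2 = 0 := by
      linear_combination hy + s ^ 2 * hx + 2 * s * hin + h
    have q0 := sq_nonneg (y.1 0 - s * x.1 0)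
    have q1 := sq_nonneg (y.1 1 - s * x.1 1)
    have q2 := sq_nonneg (y.1 2 - s * x.1 2)
    have h0 : y.1 0 = s * x.1 0 := sub_eq_zero.1 (pow_eq_zero_iff two_ne_zero |>.1
      (le_antisymm (by linarith) (sq_nonneg (y.1 0 - s * x.1 0))))
    have h1 : y.1 1 = s * x.1 1 := sub_eq_zero.1 (pow_eq_zero_iff two_ne_zero |>.1
      (le_antisymm (by linarith) (sq_nonneg (y.1 1 - s * x.1 1))))
    have h2 : y.1 2 = s * x.1 2 := sub_eq_zero.1 (pow_eq_zero_iff two_ne_zero |>.1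
      (le_antisymm (by linarith) (sq_nonneg (y.1 2 - s * x.1 2))))
    ext i
    rw [greatCircle_apply, hcos, hsin, h, Real.sqrt_zero]
    fin_cases i <;> simp [h0, h1, h2]
  · have hpos : 0 < 1 - s ^ 2 := lt_of_le_of_ne (sub_nonneg.2 ((sq_le_one_iff_abs_le_one s).2 (abs_le.2 hs1)))
      (Ne.symm h)
    have hr := Real.sq_sqrt hpos.le
    have hr0 := (Real.sqrt_pos.2 hpos).ne'
    set r := Real.sqrt (1 - s ^ 2)
    refine ⟨WithLp.toLp 2 fun i => (y.1 i - s * x.1 i) / r, ?_, ?_, ?_⟩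
    · simp only
      field_simp
      linear_combination hy + s ^ 2 * hx + 2 * s * hin - hr
    · simp only
      field_simp
      linear_combination -hin - s * hx
    · ext i
      rw [greatCircle_apply, hcos, hsin]
      simp only
      field_simp
      ring

/-- By rotation invariance it suffices to evaluate at the north pole, where the quadratic is 2z and
only the coefficient k = ℓ survives. -/
lemma norm_sq_harmVector_sphere (l : ℕ) (x : Sphere2) :
    ‖harmVector l x.1‖ ^ 2 = ((2 : ℝ) ^ l * l.factorial) ^ 2 := by
  set n : Sphere2 := ⟨!₂[0, 0, 1], by simp [EuclideanSpace.norm_eq, Fin.sum_univ_three]⟩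
  obtain ⟨e, he, hne, hxe⟩ := exists_greatCircle n x
  rw [hxe, norm_sq_harmVector_greatCircle (sphere_sq n) he hne, norm_sq_harmVector]
  have hq : nullQuadratic n.1 = Polynomial.C 2 * Polynomial.X := by
    have : (⟨0, 0⟩ : ℂ) = 0 := rfl
    simp [nullQuadratic, n, this]
  have hk : ∀ k, harmCoeff l n.1 k = if k = l then 2 ^ l else 0 := by
    intro k
    rw [harmCoeff, hq, mul_pow, ← Polynomial.C_pow, Polynomial.coeff_C_mul,
      Polynomial.coeff_X_pow]
    simp
  rw [Finset.sum_eq_single l]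
  · rw [hk, if_pos rfl, harmWeight, show 2 * l - l = l by omega]
    simp
    ring
  · intro k _ hkl
    simp [hk, hkl]
  · intro h
    exact absurd (Finset.mem_range.2 (by omega)) h

lemma norm_harmVector_sphere (l : ℕ) (x : Sphere2) :
    ‖harmVector l x.1‖ = (2 : ℝ) ^ l * l.factorial :=
  (sq_eq_sq₀ (norm_nonneg _) (by positivity)).1 (norm_sq_harmVector_sphere l x)

lemma geodesicDist_nonneg (x y : Sphere2) : 0 ≤ geodesicDist x y := Real.arccos_nonneg _

lemma norm_harmVector_sub_le (l : ℕ) (x y : Sphere2) :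
    ‖harmVector l x.1 - harmVector l y.1‖ ≤ 2 * ((2 : ℝ) ^ l * l.factorial) := by
  refine (norm_sub_le _ _).trans (le_of_eq ?_)
  rw [norm_harmVector_sphere, norm_harmVector_sphere]; ring

lemma norm_harmVector_sub_le_geodesicDist (l : ℕ) (x y : Sphere2) :
    ‖harmVector l x.1 - harmVector l y.1‖ ≤
      Real.sqrt (l * (l + 1)) * ((2 : ℝ) ^ l * l.factorial) * geodesicDist x y := by
  obtain ⟨e, he, hne, hxe⟩ := exists_greatCircle x y
  rw [norm_sub_rev, ← norm_harmVector_sphere l x]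
  conv_lhs => rw [hxe]
  exact norm_harmVector_greatCircle_sub_le (sphere_sq x) he hne l (geodesicDist_nonneg x y)

/-! ### Identification of the coefficients with the spherical harmonics -/

open Polynomial in
/-- The Taylor coefficients of `(X ^ 2 - 1) ^ l` at the height of a point give the coefficients of
the `l`-th power of `nullQuadratic`. -/
lemma harmCoeff_eq_taylor (l m : ℕ) (v : EuclideanSpace ℝ (Fin 3))
    (hv : v 0 ^ 2 + v 1 ^ 2 + v 2 ^ 2 = 1) :
    harmCoeff l v (l + m) =
      (-(⟨v 0, -v 1⟩ : ℂ)) ^ m *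
        (((hasseDeriv (l + m) ((X ^ 2 - 1 : ℝ[X]) ^ l)).eval (v 2) : ℝ) : ℂ) := by
  set a : ℂ := ⟨v 0, v 1⟩ with ha
  set b : ℂ := ⟨v 0, -v 1⟩ with hb
  have hab : a * b = 1 - (v 2 : ℂ) ^ 2 := by
    have : a * b = ((v 0 ^ 2 + v 1 ^ 2 : ℝ) : ℂ) := by
      apply Complex.ext <;> simp [a, b, sq, mul_comm]
    rw [this, show v 0 ^ 2 + v 1 ^ 2 = 1 - v 2 ^ 2 by linarith]; push_cast; ring
  have htay : (taylor (v 2) ((X ^ 2 - 1 : ℝ[X]) ^ l)).map Complex.ofRealHom =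
      (X ^ 2 + C (2 * (v 2 : ℂ)) * X + C ((v 2 : ℂ) ^ 2 - 1)) ^ l := by
    rw [taylor_pow, map_sub, taylor_pow, taylor_X, taylor_one]
    simp only [Polynomial.map_pow, Polynomial.map_sub, Polynomial.map_add, map_X, map_C,
      Complex.ofRealHom_eq_coe, Complex.ofReal_one]
    congr 1
    simp only [map_mul, map_sub, map_pow, C_ofNat, map_one]
    ring
  have hT : ∀ k, ((X ^ 2 + C (2 * (v 2 : ℂ)) * X + C ((v 2 : ℂ) ^ 2 - 1)) ^ l).coeff k =
      (((hasseDeriv k ((X ^ 2 - 1 : ℝ[X]) ^ l)).eval (v 2) : ℝ) : ℂ) := by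
    intro k
    rw [← htay, coeff_map, taylor_coeff]
    rfl
  rw [← hT]
  -- At a pole (b = 0) the rescaling z ↦ −bz used below degenerates, so both sides are computed
  -- directly.
  by_cases h0 : b = 0
  · have hc : (v 2 : ℂ) ^ 2 - 1 = 0 := by
      rw [h0, mul_zero] at hab; linear_combination hab
    have ha0 : a = 0 := by
      have := Complex.ext_iff.1 h0
      simp only [b, Complex.zero_re, Complex.zero_im, neg_eq_zero] at this
      simp [a, this.1, this.2]
      rfl
    rw [harmCoeff, nullQuadratic, ← ha, ← hb, h0, ha0, hc]
    simp only [map_zero, zero_add, zero_mul, sub_zero, add_zero]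
    rw [show (X ^ 2 + C (2 * (v 2 : ℂ)) * X) = X * (X + C (2 * (v 2 : ℂ))) by ring, mul_pow,
      mul_pow, add_comm l m, coeff_X_pow_mul, ← C_pow, coeff_C_mul, coeff_X_pow]
    rcases m with _ | m
    · simp [coeff_zero_eq_eval_zero]
    · simp
  -- Since ab = 1 − v₃², substituting −bz into the Taylor polynomial X² + 2v₃X + v₃² − 1 yields
  -- −b·q(z).
  · have hcomp : ((X ^ 2 + C (2 * (v 2 : ℂ)) * X + C ((v 2 : ℂ) ^ 2 - 1)) ^ l).comp
        (C (-b) * X) = C ((-b) ^ l) * nullQuadratic v ^ l := by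
      rw [pow_comp, C_pow, ← mul_pow]
      congr 1
      rw [show (v 2 : ℂ) ^ 2 - 1 = - (a * b) by rw [hab]; ring, nullQuadratic, ← ha, ← hb]
      simp only [add_comp, mul_comp, pow_comp, X_comp, C_comp]
      simp only [map_mul, map_neg]
      ring
    have := congrArg (fun p => p.coeff (l + m)) hcomp
    simp only [comp_C_mul_X_coeff, coeff_C_mul] at this
    have hb' : (-b) ^ l ≠ 0 := pow_ne_zero _ (neg_ne_zero.2 h0)
    apply mul_left_cancel₀ hb'
    rw [harmCoeff, ← this, pow_add]
    ring

open Polynomial in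
lemma eval_iterate_derivative_legendrePoly (l m : ℕ) (s : ℝ) :
    (derivative^[m] (legendrePoly l)).eval s =
      ((2 : ℝ) ^ l * l.factorial)⁻¹ * ((l + m).factorial *
        (hasseDeriv (l + m) ((X ^ 2 - 1 : ℝ[X]) ^ l)).eval s) := by
  have h := congrFun (factorial_smul_hasseDeriv (R := ℝ) (k := l + m)) ((X ^ 2 - 1 : ℝ[X]) ^ l)
  rw [legendrePoly, iterate_derivative_C_mul, eval_mul, eval_C, ← Function.iterate_add_apply,
    add_comm m l]
  congr 1
  have h2 := congrArg (eval s) h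
  simp at h2
  rw [← h2]

/-- Conjugation turns the factor (−ā)^m of the coefficient into (−a)^m = (−1)^m |a|^m e^{imφ}, with
|a| = √(1 − x₃²). This is the phase and the power of sin θ in Y_{ℓ,m}. The rest is Rodrigues'
formula. -/
lemma sphHarm_eq (l m : ℕ) (x : Sphere2) :
    sphHarm l m x =
      ((Real.sqrt ((2 * (l : ℝ) + 1) * ((l - m).factorial : ℝ) / ((l + m).factorial : ℝ)) *
        (((2 : ℝ) ^ l * l.factorial)⁻¹ * (l + m).factorial) : ℝ) : ℂ) *
        starRingEnd ℂ (harmCoeff l x.1 (l + m)) := by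
  have hx := sphere_sq x
  have hc : Real.cos (Real.arccos (x.1 2)) = x.1 2 := by
    apply Real.cos_arccos <;> nlinarith [sq_nonneg (x.1 0), sq_nonneg (x.1 1)]
  set a : ℂ := ⟨x.1 0, x.1 1⟩ with ha
  have hab : starRingEnd ℂ (⟨x.1 0, -x.1 1⟩ : ℂ) = a := by
    apply Complex.ext <;> simp [a]
  have hn : Real.sqrt (1 - x.1 2 ^ 2) = ‖a‖ := by
    rw [Complex.norm_def, Complex.normSq_apply]
    congr 1
    simp only [a]
    linarith
  have hexp : Complex.exp (Complex.I * m * Complex.arg a) =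
      Complex.exp (Complex.arg a * Complex.I) ^ m := by
    rw [← Complex.exp_nat_mul]; congr 1; ring
  rw [sphHarm, sphHarmAngles, assocLegendre, hc, hn, eval_iterate_derivative_legendrePoly, hexp,
    harmCoeff_eq_taylor l m x.1 hx, map_mul (starRingEnd ℂ),
    map_pow (starRingEnd ℂ), map_neg (starRingEnd ℂ), hab, Complex.conj_ofReal]
  have key : (-a) ^ m = (-1) ^ m * (‖a‖ : ℂ) ^ m * Complex.exp (Complex.arg a * Complex.I) ^ m := by
    rw [mul_assoc, ← mul_pow, Complex.norm_mul_exp_arg_mul_I, ← mul_pow]; simp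
  rw [key]
  push_cast
  ring

open Polynomial in
/-- The symmetry of the coefficients that corresponds to `Y_{l,-m} = (-1) ^ m conj Y_{l,m}`. -/
lemma harmCoeff_reflect (l m : ℕ) (hm : m ≤ l) (v : EuclideanSpace ℝ (Fin 3)) :
    harmCoeff l v (l - m) = (-1) ^ m * starRingEnd ℂ (harmCoeff l v (l + m)) := by
  have h1 : ∀ n, reflect (n * 2) (nullQuadratic v ^ n) = reflect 2 (nullQuadratic v) ^ n := by
    intro n
    induction n with
    | zero => simp
    | succ n ih =>
      rw [pow_succ, pow_succ, add_mul, one_mul, reflect_mul _ _ _ (nullQuadratic_natDegree v), ih]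
      exact natDegree_pow_le_of_le n (nullQuadratic_natDegree v)
  -- Reversing the coefficients of q gives minus the coefficientwise conjugate of q evaluated at −z.
  have h2 : reflect 2 (nullQuadratic v) =
      C (-1) * ((nullQuadratic v).map (starRingEnd ℂ)).comp (C (-1) * X) := by
    have e1 : starRingEnd ℂ (⟨v 0, -v 1⟩ : ℂ) = ⟨v 0, v 1⟩ := by
      apply Complex.ext <;> simp
    have e2 : starRingEnd ℂ (⟨v 0, v 1⟩ : ℂ) = ⟨v 0, -v 1⟩ := by
      apply Complex.ext <;> simp
    unfold nullQuadratic
    ext k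
    simp only [reflect_sub, reflect_add, reflect_C, reflect_C_mul_X_pow,
      show C (2 * (v 2 : ℂ)) * X = C (2 * (v 2 : ℂ)) * X ^ 1 by simp]
    simp only [Polynomial.map_sub, Polynomial.map_add, Polynomial.map_mul, Polynomial.map_pow,
      map_C, map_X, e1, e2, coeff_C_mul, comp_C_mul_X_coeff, coeff_sub, coeff_add, coeff_X_pow,
      coeff_C]
    have r1 : revAt 2 1 = 1 := by rw [revAt_le (by norm_num)]
    have r2 : revAt 2 2 = 0 := by rw [revAt_le (by norm_num)]
    have r3 : (starRingEnd ℂ) 2 = 2 := Complex.conj_ofNat 2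
    rcases k with _ | _ | _ | k <;> simp [r1, r2, r3]
  have h3 := congrArg (fun p => p.coeff (l + m)) (h1 l)
  simp only [coeff_reflect] at h3
  rw [revAt_le (by omega), h2, mul_pow, ← pow_comp, ← Polynomial.map_pow, ← C_pow, coeff_C_mul,
    comp_C_mul_X_coeff, coeff_map] at h3
  rw [show l - m = l * 2 - (l + m) by omega]
  unfold harmCoeff
  rw [h3, pow_add]
  have : ((-1 : ℂ) ^ l) * (-1) ^ l = 1 := by rw [← mul_pow]; simp
  linear_combination ((-1) ^ m * starRingEnd ℂ ((nullQuadratic v ^ l).coeff (l + m))) * this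

lemma sum_range_two_mul_add_one (l : ℕ) (g : ℕ → ℝ) :
    ∑ k ∈ Finset.range (2 * l + 1), g k = g l + ∑ m ∈ Finset.Icc 1 l, (g (l + m) + g (l - m)) := by
  have h1 : ∑ m ∈ Finset.Icc 1 l, (g (l + m) + g (l - m)) =
      ∑ j ∈ Finset.range l, (g (l + (1 + j)) + g (l - 1 - j)) := by
    rw [show Finset.Icc 1 l = Finset.Ico 1 (l + 1) by ext; simp,
      Finset.sum_Ico_eq_sum_range]
    refine Finset.sum_congr (by simp) fun j _ => ?_
    rw [show l - (1 + j) = l - 1 - j by omega]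
  rw [h1, Finset.sum_add_distrib, Finset.sum_range_reflect, show 2 * l + 1 = l + (l + 1) by omega,
    Finset.sum_range_add, Finset.sum_range_succ']
  simp only [add_zero, add_comm 1]
  ring

/-! ### Increments of the spherical harmonics -/

/-- The squared length of the increment of the vector of all spherical harmonics of degree `l`. -/
def sphIncrement (l : ℕ) (x y : Sphere2) : ℝ :=
  ((sphHarm l 0 x).re - (sphHarm l 0 y).re) ^ 2 +
    2 * ∑ m ∈ Finset.Icc 1 l, (((sphHarm l m x).re - (sphHarm l m y).re) ^ 2 +
      ((sphHarm l m x).im - (sphHarm l m y).im) ^ 2)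

lemma sphIncrement_nonneg (l : ℕ) (x y : Sphere2) : 0 ≤ sphIncrement l x y := by
  unfold sphIncrement
  have : 0 ≤ ∑ m ∈ Finset.Icc 1 l, (((sphHarm l m x).re - (sphHarm l m y).re) ^ 2 +
      ((sphHarm l m x).im - (sphHarm l m y).im) ^ 2) := Finset.sum_nonneg fun _ _ => by positivity
  positivity

/-- The squared normalization (ℓ−m)!/(ℓ+m)! times the ((ℓ+m)!)² from Rodrigues' formula is exactly
the weight of the index ℓ+m. -/
lemma norm_sq_sphHarm_sub (l m : ℕ) (hm : m ≤ l) (x y : Sphere2) :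
    ‖sphHarm l m x - sphHarm l m y‖ ^ 2 = (2 * l + 1) / ((2 : ℝ) ^ l * l.factorial) ^ 2 *
      (harmWeight l (l + m) * ‖harmCoeff l x.1 (l + m) - harmCoeff l y.1 (l + m)‖ ^ 2) := by
  rw [sphHarm_eq, sphHarm_eq, ← mul_sub, ← map_sub, norm_mul, mul_pow, RCLike.norm_conj,
    Complex.norm_real, Real.norm_eq_abs, sq_abs, mul_pow, Real.sq_sqrt (by positivity), harmWeight,
    show 2 * l - (l + m) = l - m by omega]
  have : ((l + m).factorial : ℝ) ≠ 0 := by positivity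
  field_simp

lemma harmVector_sub (l : ℕ) (v u : EuclideanSpace ℝ (Fin 3)) :
    ‖harmVector l v - harmVector l u‖ ^ 2 = ∑ k ∈ Finset.range (2 * l + 1),
      harmWeight l k * ‖harmCoeff l v k - harmCoeff l u k‖ ^ 2 := by
  rw [← norm_sq_toLp_weighted l fun k => harmCoeff l v k - harmCoeff l u k]
  congr 2
  ext k
  simp [harmVector, mul_sub]

/-- The indices ℓ+m and ℓ−m contribute equally by reflection, which accounts for the factor 2 in
`sphIncrement`. The inequality comes only from dropping the imaginary part of Y_{ℓ,0}. -/
lemma sphIncrement_le_harmVector (l : ℕ) (x y : Sphere2) :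
    sphIncrement l x y ≤ (2 * l + 1) / ((2 : ℝ) ^ l * l.factorial) ^ 2 *
      ‖harmVector l x.1 - harmVector l y.1‖ ^ 2 := by
  have hn : ∀ z : ℂ, ‖z‖ ^ 2 = z.re ^ 2 + z.im ^ 2 := fun z => by
    rw [Complex.sq_norm, Complex.normSq_apply]; ring
  have h0 : ((sphHarm l 0 x).re - (sphHarm l 0 y).re) ^ 2 ≤ ‖sphHarm l 0 x - sphHarm l 0 y‖ ^ 2 := by
    rw [hn, Complex.sub_re]
    nlinarith [sq_nonneg (sphHarm l 0 x - sphHarm l 0 y).im]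
  rw [harmVector_sub, sum_range_two_mul_add_one, mul_add, Finset.mul_sum, sphIncrement,
    Finset.mul_sum]
  refine add_le_add (h0.trans (le_of_eq (norm_sq_sphHarm_sub l 0 l.zero_le x y)))
    (Finset.sum_le_sum fun m hm => le_of_eq ?_)
  have hml := (Finset.mem_Icc.1 hm).2
  have e1 : ‖harmCoeff l x.1 (l - m) - harmCoeff l y.1 (l - m)‖ =
      ‖harmCoeff l x.1 (l + m) - harmCoeff l y.1 (l + m)‖ := by
    rw [harmCoeff_reflect l m hml, harmCoeff_reflect l m hml, ← mul_sub, ← map_sub, norm_mul,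
      RCLike.norm_conj]
    simp
  have e2 : harmWeight l (l - m) = harmWeight l (l + m) := by
    unfold harmWeight
    rw [show 2 * l - (l - m) = l + m by omega, show 2 * l - (l + m) = l - m by omega, mul_comm]
  rw [e1, e2, ← two_mul, mul_left_comm, ← norm_sq_sphHarm_sub l m hml, hn, Complex.sub_re,
    Complex.sub_im]

/-- Increments of spherical harmonics, in terms of the geodesic distance. -/
lemma sphIncrement_le {β : ℝ} (hβ : 0 < β) (hβ1 : β ≤ 1) {l : ℕ} (hl : 1 ≤ l) (x y : Sphere2) :
    sphIncrement l x y ≤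
      (2 : ℝ) ^ (4 - β) * (l : ℝ) ^ (1 + 2 * β) * geodesicDist x y ^ (2 * β) := by
  set N : ℝ := (2 : ℝ) ^ l * l.factorial with hN
  have hNpos : 0 < N := by positivity
  have hl' : (1 : ℝ) ≤ l := by exact_mod_cast hl
  set θ := geodesicDist x y
  have hθ : 0 ≤ θ := geodesicDist_nonneg x y
  have h0 := sphIncrement_le_harmVector l x y
  have hA : sphIncrement l x y ≤ 4 * (2 * l + 1) := by
    refine h0.trans ?_
    calc _ ≤ (2 * l + 1) / N ^ 2 * (2 * N) ^ 2 := by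
          gcongr; exact norm_harmVector_sub_le l x y
      _ = _ := by field_simp; ring
  have hB : sphIncrement l x y ≤ (2 * l + 1) * (2 * l ^ 2) * θ ^ 2 := by
    refine h0.trans ?_
    calc _ ≤ (2 * l + 1) / N ^ 2 * (Real.sqrt (l * (l + 1)) * N * θ) ^ 2 := by
          gcongr; exact norm_harmVector_sub_le_geodesicDist l x y
      _ = (2 * l + 1) * (l * (l + 1)) * θ ^ 2 := by
          rw [mul_pow _ θ, mul_pow _ N, Real.sq_sqrt (by positivity)]; field_simp
      _ ≤ _ := by
          have : (l : ℝ) * (l + 1) ≤ 2 * l ^ 2 := by nlinarith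
          exact mul_le_mul_of_nonneg_right (mul_le_mul_of_nonneg_left this (by positivity))
            (by positivity)
  have hD := sphIncrement_nonneg l x y
  -- Interpolation: `hA` is used with exponent 1−β and `hB` with exponent β. The constant is
  -- 4^{1−β}·2^β = 2^{2−β}, times 4 from 2ℓ+1 ≤ 4ℓ.
  have hsplit : sphIncrement l x y = sphIncrement l x y ^ (1 - β) * sphIncrement l x y ^ β := by
    rw [← Real.rpow_add_of_nonneg hD (by linarith) hβ.le]; simp
  calc sphIncrement l x y = sphIncrement l x y ^ (1 - β) * sphIncrement l x y ^ β := hsplit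
    _ ≤ (4 * (2 * l + 1)) ^ (1 - β) * ((2 * l + 1) * (2 * l ^ 2) * θ ^ 2) ^ β := by
        gcongr
    _ = (2 * l + 1) * (2 : ℝ) ^ (2 - β) * (l : ℝ) ^ (2 * β) * θ ^ (2 * β) := by
        rw [Real.mul_rpow (by norm_num) (by positivity), Real.mul_rpow (by positivity)
          (by positivity), Real.mul_rpow (by positivity) (by positivity),
          Real.mul_rpow (by norm_num) (by positivity), ← Real.rpow_natCast_mul (by positivity),
          ← Real.rpow_natCast_mul hθ, show (4 : ℝ) = 2 ^ ((2 : ℕ) : ℝ) by norm_num,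
          ← Real.rpow_mul (by norm_num), show (2 : ℝ) - β = ((2 : ℕ) : ℝ) * (1 - β) + β by
            push_cast; ring, Real.rpow_add (by norm_num)]
        have : (2 * (l : ℝ) + 1) ^ (1 - β) * (2 * (l : ℝ) + 1) ^ β = 2 * l + 1 := by
          rw [← Real.rpow_add (by positivity)]; simp
        push_cast
        linear_combination ((2 : ℝ) ^ ((2 : ℝ) * (1 - β)) * 2 ^ β * (l : ℝ) ^ (2 * β) *
          θ ^ (2 * β)) * this
    _ ≤ (4 * l) * (2 : ℝ) ^ (2 - β) * (l : ℝ) ^ (2 * β) * θ ^ (2 * β) := by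
        gcongr; linarith
    _ = _ := by
        rw [Real.rpow_add (by positivity), Real.rpow_one,
          show (4 : ℝ) - β = (2 - β) + 2 by ring, Real.rpow_add (by norm_num) (2 - β) 2]
        rw [show (2 : ℝ) ^ (2 : ℝ) = 4 by norm_num]
        ring

lemma sphIncrement_zero (x y : Sphere2) : sphIncrement 0 x y = 0 := by
  have h : ∀ x : Sphere2, sphHarm 0 0 x = 1 := by
    intro x
    simp [sphHarm, sphHarmAngles, assocLegendre, legendrePoly]
  simp [sphIncrement, h]

/-! ### The Mittag-Leffler function on the negative half line -/

/-- Keep only x > M in Euler's integral, where x^s ≥ M^s. With M free, Γ outgrows every geometric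
sequence. -/
lemma rpow_mul_exp_neg_le_Gamma {M s : ℝ} (hM : 0 < M) (hs : 0 ≤ s) :
    M ^ s * Real.exp (-M) ≤ Real.Gamma (s + 1) := by
  have hint := Real.GammaIntegral_convergent (s := s + 1) (by linarith)
  simp only [add_sub_cancel_right] at hint
  have hsub : Set.Ioi M ⊆ Set.Ioi 0 := Set.Ioi_subset_Ioi hM.le
  rw [Real.Gamma_eq_integral (by linarith)]
  simp only [add_sub_cancel_right]
  calc M ^ s * Real.exp (-M) = ∫ x in Set.Ioi M, Real.exp (-x) * M ^ s := by
        rw [integral_mul_const, integral_exp_neg_Ioi, mul_comm]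
    _ ≤ ∫ x in Set.Ioi M, Real.exp (-x) * x ^ s := by
        refine setIntegral_mono_on ?_ (hint.mono_set hsub) measurableSet_Ioi fun x hx => ?_
        · exact (integrableOn_exp_neg_Ioi M).mul_const _
        · have : M ^ s ≤ x ^ s := Real.rpow_le_rpow hM.le (le_of_lt hx) hs
          gcongr
    _ ≤ ∫ x in Set.Ioi 0, Real.exp (-x) * x ^ s := by
        refine setIntegral_mono_set hint ?_ hsub.eventuallyLE
        filter_upwards [ae_restrict_mem measurableSet_Ioi] with x hx
        have : (0 : ℝ) < x := hx
        positivity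

lemma Gamma_mul_add_one_pos {α : ℝ} (hα : 0 < α) (k : ℕ) : 0 < Real.Gamma (α * k + 1) :=
  Real.Gamma_pos_of_pos (by positivity)

lemma summable_pow_div_Gamma {α : ℝ} (hα : 0 < α) (z : ℝ) :
    Summable fun k : ℕ => z ^ k / Real.Gamma (α * k + 1) := by
  -- This M makes M^{αk} = (2|z|+1)^k, so the series is dominated by a geometric one with ratio
  -- |z|/(2|z|+1) < 1.
  set M : ℝ := (2 * |z| + 1) ^ α⁻¹
  have hb : 0 < 2 * |z| + 1 := by positivity
  have hM : 0 < M := Real.rpow_pos_of_pos hb _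
  have hMα : M ^ α = 2 * |z| + 1 := Real.rpow_inv_rpow hb.le hα.ne'
  have hr : |z| / (2 * |z| + 1) < 1 := (div_lt_one hb).2 (by linarith [abs_nonneg z])
  refine Summable.of_norm_bounded (g := fun k => Real.exp M * (|z| / (2 * |z| + 1)) ^ k)
    ((summable_geometric_of_lt_one (by positivity) hr).mul_left _) fun k => ?_
  have h1 := rpow_mul_exp_neg_le_Gamma hM (s := α * k) (by positivity)
  rw [Real.rpow_mul hM.le, hMα, Real.rpow_natCast] at h1
  have h2 := Gamma_mul_add_one_pos hα k
  rw [norm_div, norm_pow, Real.norm_eq_abs, Real.norm_of_nonneg h2.le, div_pow, div_le_iff₀ h2]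
  calc |z| ^ k = Real.exp M * (|z| ^ k / (2 * |z| + 1) ^ k) *
        ((2 * |z| + 1) ^ k * Real.exp (-M)) := by
        rw [Real.exp_neg]; field_simp
    _ ≤ _ := by gcongr

lemma continuous_mittagLeffler {α : ℝ} (hα : 0 < α) : Continuous (mittagLeffler α) := by
  rw [continuous_iff_continuousAt]
  intro x
  set R := |x| + 1
  have h : ContinuousOn (mittagLeffler α) (Metric.ball 0 R) := by
    refine continuousOn_tsum (fun k => by fun_prop) (summable_pow_div_Gamma hα R) fun k y hy => ?_
    have hy' : |y| ≤ R := by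
      have := (mem_ball_zero_iff.1 hy).le
      simpa using this
    rw [norm_div, norm_pow, Real.norm_eq_abs, Real.norm_of_nonneg (Gamma_mul_add_one_pos hα k).le]
    have := Gamma_mul_add_one_pos hα k
    gcongr
  exact h.continuousAt (Metric.isOpen_ball.mem_nhds (by simp [R]))

lemma intervalIntegrable_beta {p q : ℝ} (hp : 0 < p) (hq : 0 < q) :
    IntervalIntegrable (fun r : ℝ => r ^ (p - 1) * (1 - r) ^ (q - 1)) volume 0 1 ∧
      ∫ r in (0 : ℝ)..1, r ^ (p - 1) * (1 - r) ^ (q - 1) =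
        Real.Gamma p * Real.Gamma q / Real.Gamma (p + q) := by
  have hconv := Complex.betaIntegral_convergent (u := (p : ℂ)) (v := (q : ℂ)) (by simpa) (by simpa)
  have heq : Set.EqOn (fun r : ℝ => (r : ℂ) ^ ((p : ℂ) - 1) * (1 - (r : ℂ)) ^ ((q : ℂ) - 1))
      (fun r : ℝ => ((r ^ (p - 1) * (1 - r) ^ (q - 1) : ℝ) : ℂ)) (Set.Ioc 0 1) := by
    intro r hr
    simp only
    rw [Complex.ofReal_mul, Complex.ofReal_cpow hr.1.le, Complex.ofReal_cpow (by linarith [hr.2])]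
    push_cast
    rfl
  have h1 := ProbabilityTheory.beta_eq_betaIntegralReal p q hp hq
  rw [Complex.betaIntegral, intervalIntegral.integral_of_le zero_le_one,
    setIntegral_congr_fun measurableSet_Ioc heq, integral_complex_ofReal, Complex.ofReal_re] at h1
  rw [intervalIntegrable_iff_integrableOn_Ioc_of_le zero_le_one] at hconv ⊢
  refine ⟨?_, ?_⟩
  · have := (integrableOn_congr_fun heq measurableSet_Ioc).1 hconv
    rw [IntegrableOn]
    simpa using this.re
  · rw [intervalIntegral.integral_of_le zero_le_one, ← h1, beta]

/-- Bernoulli's inequality for p ≥ 1, monotonicity in the exponent for p ≤ 1. The factor 1−r lowers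
the singularity (1−r)^{−α−1} to the integrable (1−r)^{−α}. -/
lemma one_sub_rpow_le {p r : ℝ} (hr0 : 0 < r) (hr1 : r < 1) :
    1 - r ^ p ≤ max p 1 * (1 - r) := by
  rcases le_total p 1 with h | h
  · have := Real.rpow_le_rpow_of_exponent_ge hr0 hr1.le h
    rw [Real.rpow_one] at this
    rw [max_eq_right h]; linarith
  · have := one_add_mul_self_le_rpow_one_add (s := r - 1) (by linarith) h
    rw [max_eq_left h]
    rw [show 1 + (r - 1) = r by ring] at this
    linarith

lemma intervalIntegrable_fractionalKernel {α p : ℝ} (hα1 : α < 1) (hp : 0 < p) :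
    IntervalIntegrable (fun r : ℝ => (1 - r ^ p) * (1 - r) ^ (-α - 1)) volume 0 1 := by
  have hb := (intervalIntegrable_beta (p := 1) (q := 1 - α) one_pos (by linarith)).1
  simp only [sub_self, Real.rpow_zero, one_mul] at hb
  rw [intervalIntegrable_iff_integrableOn_Ioo_of_le zero_le_one] at hb ⊢
  refine Integrable.mono' (hb.const_mul (max p 1)) ?_ ?_
  · refine Measurable.aestronglyMeasurable ?_
    fun_prop
  · filter_upwards [ae_restrict_mem measurableSet_Ioo] with r hr
    have h1 : 0 < 1 - r := by linarith [hr.2]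
    have h2 : 0 ≤ 1 - r ^ p := by
      have := Real.rpow_le_one hr.1.le hr.2.le hp.le
      linarith
    rw [norm_mul, Real.norm_of_nonneg h2, Real.norm_of_nonneg (by positivity)]
    calc _ ≤ (max p 1 * (1 - r)) * (1 - r) ^ (-α - 1) := by
          gcongr; exact one_sub_rpow_le hr.1 hr.2
      _ = _ := by
          rw [mul_assoc]
          congr 1
          rw [show 1 - α - 1 = 1 + (-α - 1) by ring, Real.rpow_add h1, Real.rpow_one]

/-- Integrate the derivative of (1−r^p)(1−r)^{−α}, which tends to 1 at r = 0 and to 0 at r = 1. The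
remaining term is a Beta integral. In effect this is the fractional derivative of t^p at t = 1. -/
lemma integral_fractionalKernel {α p : ℝ} (hα1 : α < 1) (hp : 0 < p) :
    α * ∫ r in (0 : ℝ)..1, (1 - r ^ p) * (1 - r) ^ (-α - 1) =
      Real.Gamma (1 - α) * Real.Gamma (p + 1) / Real.Gamma (p + 1 - α) - 1 := by
  have hb := intervalIntegrable_beta (p := p) (q := 1 - α) hp (by linarith)
  have hk := intervalIntegrable_fractionalKernel hα1 hp
  have hderiv : ∀ r ∈ Set.Ioo (0 : ℝ) 1, HasDerivAt (fun r : ℝ => (1 - r ^ p) * (1 - r) ^ (-α))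
      (α * ((1 - r ^ p) * (1 - r) ^ (-α - 1)) - p * (r ^ (p - 1) * (1 - r) ^ (1 - α - 1))) r := by
    intro r hr
    have h1 : 0 < 1 - r := by linarith [hr.2]
    have d1 : HasDerivAt (fun r : ℝ => 1 - r ^ p) (-(p * r ^ (p - 1))) r :=
      (Real.hasDerivAt_rpow_const (Or.inl hr.1.ne')).const_sub 1
    have d2 : HasDerivAt (fun r : ℝ => (1 - r) ^ (-α)) (-1 * -α * (1 - r) ^ (-α - 1)) r :=
      ((hasDerivAt_id r).const_sub 1).rpow_const (Or.inl h1.ne')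
    refine (d1.mul d2).congr_deriv ?_
    rw [show 1 - α - 1 = -α by ring]
    ring
  have hint := (hk.const_mul α).sub (hb.1.const_mul p)
  have h0 : Tendsto (fun r : ℝ => (1 - r ^ p) * (1 - r) ^ (-α)) (𝓝[>] 0) (𝓝 1) := by
    have hc : ContinuousAt (fun r : ℝ => (1 - r ^ p) * (1 - r) ^ (-α)) 0 := by
      refine ContinuousAt.mul ?_ ?_
      · exact continuousAt_const.sub (Real.continuousAt_rpow_const _ _ (Or.inr hp.le))
      · exact ContinuousAt.rpow_const (by fun_prop) (Or.inl (by norm_num))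
    have := hc.tendsto.mono_left (nhdsWithin_le_nhds (s := Set.Ioi 0))
    simpa [Real.zero_rpow hp.ne'] using this
  have h1 : Tendsto (fun r : ℝ => (1 - r ^ p) * (1 - r) ^ (-α)) (𝓝[<] 1) (𝓝 0) := by
    have hlim : Tendsto (fun r : ℝ => max p 1 * (1 - r) ^ (1 - α)) (𝓝[<] 1) (𝓝 0) := by
      have hc : ContinuousAt (fun r : ℝ => max p 1 * (1 - r) ^ (1 - α)) 1 :=
        continuousAt_const.mul
          (ContinuousAt.rpow_const (by fun_prop) (Or.inr (by linarith)))
      have := hc.tendsto.mono_left (nhdsWithin_le_nhds (s := Set.Iio 1))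
      simpa [Real.zero_rpow (show 1 - α ≠ 0 by linarith)] using this
    have hIoo : Set.Ioo (0 : ℝ) 1 ∈ 𝓝[<] (1 : ℝ) := Ioo_mem_nhdsLT zero_lt_one
    refine squeeze_zero' ?_ ?_ hlim
    · filter_upwards [hIoo] with r hr
      have h1 : 0 < 1 - r := by linarith [hr.2]
      have := Real.rpow_le_one hr.1.le hr.2.le hp.le
      have h2 : 0 ≤ 1 - r ^ p := by linarith
      positivity
    · filter_upwards [hIoo] with r hr
      have h1 : 0 < 1 - r := by linarith [hr.2]
      calc _ ≤ (max p 1 * (1 - r)) * (1 - r) ^ (-α) := by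
            gcongr; exact one_sub_rpow_le hr.1 hr.2
        _ = _ := by
            rw [mul_assoc, show 1 - α = 1 + (-α) by ring, Real.rpow_add h1, Real.rpow_one]
  have := intervalIntegral.integral_eq_sub_of_hasDerivAt_of_tendsto zero_lt_one hderiv hint h0 h1
  rw [intervalIntegral.integral_sub (hk.const_mul α) (hb.1.const_mul p),
    intervalIntegral.integral_const_mul, intervalIntegral.integral_const_mul, hb.2] at this
  rw [Real.Gamma_add_one hp.ne', show p + 1 - α = p + (1 - α) by ring]
  linear_combination this

/-- The equation satisfied by the Mittag-Leffler function, with the fractional derivative written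
as a singular integral of increments. -/
lemma mittagLeffler_neg_mul_eq {α x : ℝ} (hα : 0 < α) (hα1 : α < 1) (hx : 0 ≤ x) :
    mittagLeffler α (-x) * (1 + x * Real.Gamma (1 - α)) =
      1 - α * ∫ r in (0 : ℝ)..1,
        (mittagLeffler α (-x) - mittagLeffler α (-(x * r ^ α))) * (1 - r) ^ (-α - 1) := by
  set a : ℕ → ℝ := fun k => (-x) ^ k / Real.Gamma (α * k + 1) with ha
  have hsum : ∀ y, Summable fun k : ℕ => y ^ k / Real.Gamma (α * k + 1) :=
    summable_pow_div_Gamma hα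
  have hpk : ∀ k : ℕ, 0 < α * (k + 1 : ℕ) := fun k => by positivity
  have hG : ∀ k : ℕ, 0 < Real.Gamma (α * k + 1) := Gamma_mul_add_one_pos hα
  have hG1 : 0 < Real.Gamma (1 - α) := Real.Gamma_pos_of_pos (by linarith)
  set F : ℕ → ℝ → ℝ := fun k r => a (k + 1) * ((1 - r ^ (α * (k + 1 : ℕ))) * (1 - r) ^ (-α - 1))
    with hF
  -- With p = α(k+1) the denominator Γ(p+1−α) is Γ(αk+1): the operator sends the term of index k+1
  -- back to index k, which is what closes the equation.
  have hFint : ∀ k, ∫ r in (0 : ℝ)..1, (1 - r ^ (α * (k + 1 : ℕ))) * (1 - r) ^ (-α - 1) =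
      α⁻¹ * (Real.Gamma (1 - α) * Real.Gamma (α * (k + 1 : ℕ) + 1) / Real.Gamma (α * k + 1) - 1) := by
    intro k
    have := integral_fractionalKernel hα1 (hpk k)
    rw [show α * ((k + 1 : ℕ) : ℝ) + 1 - α = α * k + 1 by push_cast; ring] at this
    rw [← this]; field_simp
  have hFi : ∀ k, IntegrableOn (F k) (Set.Ioc 0 1) := by
    intro k
    have := (intervalIntegrable_fractionalKernel hα1 (hpk k)).const_mul (a (k + 1))
    rwa [intervalIntegrable_iff_integrableOn_Ioc_of_le zero_le_one] at this
  have hnorm : ∀ k, ∫ r in Set.Ioc (0 : ℝ) 1, ‖F k r‖ = |a (k + 1)| * (α⁻¹ *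
      (Real.Gamma (1 - α) * Real.Gamma (α * (k + 1 : ℕ) + 1) / Real.Gamma (α * k + 1) - 1)) := by
    intro k
    rw [← hFint, intervalIntegral.integral_of_le zero_le_one, ← integral_const_mul]
    refine setIntegral_congr_fun measurableSet_Ioc fun r hr => ?_
    have h1 : 0 ≤ 1 - r := by linarith [hr.2]
    have := Real.rpow_le_one hr.1.le hr.2 (hpk k).le
    have h2 : 0 ≤ 1 - r ^ (α * (k + 1 : ℕ)) := by linarith
    simp only [hF, norm_mul, Real.norm_eq_abs]
    rw [abs_of_nonneg h2, abs_of_nonneg (Real.rpow_nonneg h1 _)]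
  have habs : ∀ k, |a k| = x ^ k / Real.Gamma (α * k + 1) := by
    intro k
    simp only [ha]
    rw [abs_div, abs_pow, abs_neg, abs_of_nonneg hx, abs_of_pos (hG k)]
  -- Dropping the −1, the k-th norm is at most α⁻¹ x Γ(1−α) times the k-th term of E_α(x). This
  -- justifies integrating the series termwise.
  have hsumnorm : Summable fun k => ∫ r in Set.Ioc (0 : ℝ) 1, ‖F k r‖ := by
    simp only [hnorm]
    refine Summable.of_nonneg_of_le (fun k => ?_) (fun k => ?_)
      (((hsum x).mul_left (α⁻¹ * x * Real.Gamma (1 - α))))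
    · rw [← hnorm]; exact integral_nonneg fun _ => norm_nonneg _
    · rw [habs]
      have h1 := hG (k + 1)
      have h2 := hG k
      calc _ ≤ x ^ (k + 1) / Real.Gamma (α * (k + 1 : ℕ) + 1) * (α⁻¹ *
            (Real.Gamma (1 - α) * Real.Gamma (α * (k + 1 : ℕ) + 1) / Real.Gamma (α * k + 1))) := by
            gcongr; linarith
        _ = _ := by field_simp; ring
  have key := hasSum_integral_of_summable_integral_norm (μ := volume.restrict (Set.Ioc (0 : ℝ) 1))
    hFi hsumnorm
  have hval : ∀ k, ∫ r in Set.Ioc (0 : ℝ) 1, F k r =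
      α⁻¹ * (-(x * Real.Gamma (1 - α)) * a k - a (k + 1)) := by
    intro k
    rw [integral_const_mul, ← intervalIntegral.integral_of_le zero_le_one, hFint]
    have h1 := (hG (k + 1)).ne'
    have h2 := (hG k).ne'
    simp only [ha]
    field_simp
    ring
  have hpoint : ∀ r ∈ Set.Ioc (0 : ℝ) 1, ∑' k, F k r =
      (mittagLeffler α (-x) - mittagLeffler α (-(x * r ^ α))) * (1 - r) ^ (-α - 1) := by
    intro r hr
    have h1 : HasSum a (mittagLeffler α (-x)) := (hsum (-x)).hasSum
    have h2 : HasSum (fun k => a k * r ^ (α * k)) (mittagLeffler α (-(x * r ^ α))) := by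
      have e : (fun k : ℕ => a k * r ^ (α * k)) =
          fun k : ℕ => (-(x * r ^ α)) ^ k / Real.Gamma (α * k + 1) := by
        funext k
        rw [Real.rpow_mul hr.1.le, Real.rpow_natCast, neg_mul_eq_neg_mul, mul_pow]
        simp only [ha]
        ring
      rw [e]
      exact (hsum (-(x * r ^ α))).hasSum
    have h3 := (hasSum_nat_add_iff' 1).2 (h1.sub h2)
    simp only [Finset.sum_range_one, Nat.cast_zero, mul_zero, Real.rpow_zero, mul_one, sub_self,
      sub_zero] at h3
    have e : (fun k => F k r) = fun k =>
        (a (k + 1) - a (k + 1) * r ^ (α * (k + 1 : ℕ))) * (1 - r) ^ (-α - 1) := by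
      funext k
      simp only [hF]
      ring
    rw [e]
    exact (h3.mul_right _).tsum_eq
  have hS : HasSum a (mittagLeffler α (-x)) := (hsum (-x)).hasSum
  have hS1 := (hasSum_nat_add_iff' 1).2 hS
  have hrhs := ((hS.mul_left (-(x * Real.Gamma (1 - α)))).sub hS1).mul_left α⁻¹
  simp only [hval] at key
  have := key.unique hrhs
  rw [setIntegral_congr_fun measurableSet_Ioc hpoint,
    ← intervalIntegral.integral_of_le zero_le_one] at this
  rw [this]
  have ha0 : a 0 = 1 := by simp [ha]
  simp only [Finset.sum_range_one, ha0]
  field_simp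
  ring

/-- `0 < E_α(-x) ≤ 1` for `0 < α < 1` and `x ≥ 0`: a maximum principle. -/
lemma mittagLeffler_neg_mem {α x : ℝ} (hα : 0 < α) (hα1 : α < 1) (hx : 0 ≤ x) :
    0 < mittagLeffler α (-x) ∧ mittagLeffler α (-x) ≤ 1 := by
  have hG1 : 0 < Real.Gamma (1 - α) := Real.Gamma_pos_of_pos (by linarith)
  have hcont : ContinuousOn (fun y => mittagLeffler α (-y)) (Set.Icc 0 x) :=
    ((continuous_mittagLeffler hα).comp continuous_neg).continuousOn
  have hne : (Set.Icc 0 x).Nonempty := ⟨0, Set.left_mem_Icc.2 hx⟩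
  have hmem : ∀ z ∈ Set.Icc 0 x, ∀ r ∈ Set.Icc (0 : ℝ) 1, z * r ^ α ∈ Set.Icc 0 x := by
    intro z hz r hr
    have h1 := Real.rpow_le_one hr.1 hr.2 hα.le
    have h0 := Real.rpow_nonneg hr.1 α
    exact ⟨mul_nonneg hz.1 h0, (mul_le_of_le_one_right hz.1 h1).trans hz.2⟩
  constructor
  -- At a minimum z on [0, x] all increments are nonpositive, because z r^α stays in [0, x]. So
  -- E_α(−z)(1 + zΓ(1−α)) ≥ 1.
  · obtain ⟨z, hz, hmin⟩ := isCompact_Icc.exists_isMinOn hne hcont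
    refine lt_of_lt_of_le ?_ (hmin (Set.right_mem_Icc.2 hx))
    have hle : ∫ r in (0 : ℝ)..1, (mittagLeffler α (-z) - mittagLeffler α (-(z * r ^ α))) *
        (1 - r) ^ (-α - 1) ≤ 0 := by
      rw [← neg_nonneg, ← intervalIntegral.integral_neg]
      refine intervalIntegral.integral_nonneg zero_le_one fun r hr => ?_
      have h1 : mittagLeffler α (-z) ≤ mittagLeffler α (-(z * r ^ α)) := hmin (hmem z hz r hr)
      rw [← neg_mul]
      exact mul_nonneg (by linarith) (Real.rpow_nonneg (by linarith [hr.2]) _)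
    have heq := mittagLeffler_neg_mul_eq hα hα1 hz.1
    have hpos : 0 < 1 + z * Real.Gamma (1 - α) := by nlinarith [hz.1]
    have : 0 < mittagLeffler α (-z) * (1 + z * Real.Gamma (1 - α)) := by
      rw [heq]; nlinarith
    by_contra hcon
    exact absurd this (not_lt.2 (mul_nonpos_of_nonpos_of_nonneg (not_lt.1 hcon) hpos.le))
  -- At a maximum the increments are nonnegative, so E_α(−z)(1 + zΓ(1−α)) ≤ 1, which excludes
  -- E_α(−z) > 1.
  · obtain ⟨z, hz, hmax⟩ := isCompact_Icc.exists_isMaxOn hne hcont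
    refine (hmax (Set.right_mem_Icc.2 hx)).trans ?_
    have hge : 0 ≤ ∫ r in (0 : ℝ)..1, (mittagLeffler α (-z) - mittagLeffler α (-(z * r ^ α))) *
        (1 - r) ^ (-α - 1) := by
      refine intervalIntegral.integral_nonneg zero_le_one fun r hr => ?_
      have h1 : mittagLeffler α (-(z * r ^ α)) ≤ mittagLeffler α (-z) := hmax (hmem z hz r hr)
      exact mul_nonneg (by linarith) (Real.rpow_nonneg (by linarith [hr.2]) _)
    have heq := mittagLeffler_neg_mul_eq hα hα1 hz.1
    by_contra hcon
    push Not at hcon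
    have hzG : 0 ≤ z * Real.Gamma (1 - α) := mul_nonneg hz.1 hG1.le
    nlinarith [mul_nonneg hα.le hge]

lemma abs_mittagLeffler_neg_le_one {α x : ℝ} (hα : 0 < α) (hα1 : α ≤ 1) (hx : 0 ≤ x) :
    |mittagLeffler α (-x)| ≤ 1 := by
  rcases hα1.lt_or_eq with h | rfl
  · obtain ⟨h1, h2⟩ := mittagLeffler_neg_mem hα h hx
    rwa [abs_of_pos h1]
  · have : mittagLeffler 1 (-x) = Real.exp (-x) := by
      rw [Real.exp_eq_exp_ℝ, NormedSpace.exp_eq_tsum_div, mittagLeffler]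
      simp [Real.Gamma_nat_eq_factorial]
    rw [this, abs_of_pos (Real.exp_pos _)]
    exact Real.exp_le_one_iff.2 (by linarith)

/-! ### Sub-Gaussian random variables -/

section SubGaussian

variable {Ω : Type*} [MeasurableSpace Ω] {P : Measure Ω}

lemma hasSubgaussianMGF_of_hasLaw_gaussianReal {X : Ω → ℝ} {v : ℝ≥0}
    (h : HasLaw X (gaussianReal 0 v) P) : HasSubgaussianMGF X v P := by
  refine ⟨fun t => ?_, fun t => ?_⟩
  · have := integrable_exp_mul_gaussianReal (μ := 0) (v := v) t
    rw [← h.map_eq] at this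
    exact this.comp_aemeasurable h.aemeasurable
  · rw [mgf_gaussianReal h.map_eq]
    simp

/-- Sub-Gaussian bounds pass to limits in `L²`. -/
lemma hasSubgaussianMGF_of_tendsto {X : ℕ → Ω → ℝ} {Y : Ω → ℝ} {c : ℕ → ℝ≥0} {d : ℝ≥0}
    (hX : ∀ n, HasSubgaussianMGF (X n) (c n) P) (hY : AEStronglyMeasurable Y P)
    (hc : Tendsto c atTop (𝓝 d))
    (hlim : Tendsto (fun n => eLpNorm (fun ω => X n ω - Y ω) 2 P) atTop (𝓝 0)) :
    HasSubgaussianMGF Y d P := by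
  -- Along an almost surely convergent subsequence, Fatou's lemma for exp(tX) carries the moment
  -- generating function bound to the limit, and integrability with it.
  obtain ⟨ns, hns, hae⟩ := (tendstoInMeasure_of_tendsto_eLpNorm (p := 2) (by norm_num)
    (fun n => (hX n).aestronglyMeasurable) hY hlim).exists_seq_tendsto_ae
  have key : ∀ t : ℝ, ∫⁻ ω, ENNReal.ofReal (Real.exp (t * Y ω)) ∂P ≤
      ENNReal.ofReal (Real.exp (d * t ^ 2 / 2)) := by
    intro t
    have hb : ∀ n, ∫⁻ ω, ENNReal.ofReal (Real.exp (t * X (ns n) ω)) ∂P ≤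
        ENNReal.ofReal (Real.exp (c (ns n) * t ^ 2 / 2)) := by
      intro n
      rw [← ofReal_integral_eq_lintegral_ofReal ((hX _).integrable_exp_mul t)
        (ae_of_all _ fun ω => (Real.exp_pos _).le)]
      exact ENNReal.ofReal_le_ofReal ((hX _).mgf_le t)
    have hct : Tendsto (fun n => ENNReal.ofReal (Real.exp (c (ns n) * t ^ 2 / 2))) atTop
        (𝓝 (ENNReal.ofReal (Real.exp (d * t ^ 2 / 2)))) := by
      refine ENNReal.tendsto_ofReal ((Real.continuous_exp.tendsto _).comp ?_)
      exact ((NNReal.tendsto_coe.2 (hc.comp hns.tendsto_atTop)).mul_const _).div_const _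
    calc ∫⁻ ω, ENNReal.ofReal (Real.exp (t * Y ω)) ∂P
        = ∫⁻ ω, liminf (fun n => ENNReal.ofReal (Real.exp (t * X (ns n) ω))) atTop ∂P := by
          refine lintegral_congr_ae ?_
          filter_upwards [hae] with ω hω
          refine (Tendsto.liminf_eq ?_).symm
          exact ENNReal.tendsto_ofReal ((Real.continuous_exp.tendsto _).comp (hω.const_mul t))
      _ ≤ liminf (fun n => ∫⁻ ω, ENNReal.ofReal (Real.exp (t * X (ns n) ω)) ∂P) atTop := by
          refine lintegral_liminf_le' fun n => ?_
          have := (hX (ns n)).aemeasurable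
          fun_prop
      _ ≤ liminf (fun n => ENNReal.ofReal (Real.exp (c (ns n) * t ^ 2 / 2))) atTop :=
          liminf_le_liminf (Eventually.of_forall hb)
      _ = _ := hct.liminf_eq
  have hint : ∀ t : ℝ, Integrable (fun ω => Real.exp (t * Y ω)) P := by
    intro t
    refine ⟨Real.continuous_exp.comp_aestronglyMeasurable (hY.const_mul t), ?_⟩
    rw [hasFiniteIntegral_iff_ofReal (ae_of_all _ fun ω => (Real.exp_pos _).le)]
    exact (key t).trans_lt ENNReal.ofReal_lt_top
  refine ⟨hint, fun t => ?_⟩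
  have := key t
  rw [← ofReal_integral_eq_lintegral_ofReal (hint t) (ae_of_all _ fun ω => (Real.exp_pos _).le),
    ENNReal.ofReal_le_ofReal_iff (Real.exp_pos _).le] at this
  exact this

lemma ProbabilityTheory.HasSubgaussianMGF.of_le {X : Ω → ℝ} {c d : ℝ≥0} (h : HasSubgaussianMGF X c P)
    (hcd : c ≤ d) : HasSubgaussianMGF X d P := by
  refine ⟨h.integrable_exp_mul, fun t => (h.mgf_le t).trans ?_⟩
  have : (c : ℝ) ≤ d := hcd
  gcongr

lemma one_add_sq_div_two_le_cosh (y : ℝ) : 1 + y ^ 2 / 2 ≤ Real.cosh y := by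
  have h : |y| / 2 ≤ Real.sinh (|y| / 2) := Real.self_le_sinh_iff.2 (by positivity)
  have h2 := Real.cosh_two_mul (|y| / 2)
  rw [show 2 * (|y| / 2) = |y| by ring, Real.cosh_abs, Real.cosh_sq] at h2
  have h3 : (|y| / 2) ^ 2 ≤ Real.sinh (|y| / 2) ^ 2 := by gcongr
  rw [div_pow, sq_abs] at h3
  linarith

/-- Second-order comparison at s = 0: 1 + s²E[X²]/2 ≤ E cosh(sX) ≤ e^{cs²/2} ≤ 1 + cs²/2 + (cs²/2)².
Dividing by s²/2 and letting s → 0 gives E[X²] ≤ c with no loss in the constant. -/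
lemma ProbabilityTheory.HasSubgaussianMGF.variance_le [IsProbabilityMeasure P] {X : Ω → ℝ} {c : ℝ≥0}
    (h : HasSubgaussianMGF X c P) : variance X P ≤ c := by
  have hX2 : Integrable (fun ω => X ω ^ 2) P := by
    simpa using (h.memLp 2).integrable_sq
  refine (variance_le_expectation_sq h.aestronglyMeasurable).trans ?_
  have hbound : ∀ s : ℝ, 0 < s → c * s ^ 2 / 2 ≤ 1 →
      ∫ ω, X ω ^ 2 ∂P ≤ c + c ^ 2 * s ^ 2 / 2 := by
    intro s hs hs1
    have h1 : ∫ ω, (1 + s ^ 2 / 2 * X ω ^ 2) ∂P ≤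
        ∫ ω, (1 / 2 * Real.exp (s * X ω) + 1 / 2 * Real.exp (-s * X ω)) ∂P := by
      refine integral_mono ((integrable_const 1).add (hX2.const_mul _))
        (((h.integrable_exp_mul s).const_mul _).add ((h.integrable_exp_mul (-s)).const_mul _)) ?_
      intro ω
      have := one_add_sq_div_two_le_cosh (s * X ω)
      rw [Real.cosh_eq] at this
      simp only [neg_mul]
      nlinarith
    rw [integral_add (integrable_const 1) (hX2.const_mul _), integral_const_mul,
      integral_add ((h.integrable_exp_mul s).const_mul _)
        ((h.integrable_exp_mul (-s)).const_mul _), integral_const_mul, integral_const_mul] at h1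
    have h2 := h.mgf_le s
    have h3 := h.mgf_le (-s)
    simp only [mgf, neg_sq] at h2 h3
    have hu : (0 : ℝ) ≤ c * s ^ 2 / 2 := by positivity
    have h4 := (abs_le.1 (Real.abs_exp_sub_one_sub_id_le (abs_le.2 ⟨by linarith, hs1⟩))).2
    simp only [integral_const, probReal_univ, smul_eq_mul, mul_one] at h1
    have h5 : s ^ 2 / 2 * ∫ ω, X ω ^ 2 ∂P ≤ s ^ 2 / 2 * (c + c ^ 2 * s ^ 2 / 2) := by
      nlinarith
    exact le_of_mul_le_mul_left h5 (by positivity)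
  have hlim : Tendsto (fun s : ℝ => (c : ℝ) + c ^ 2 * s ^ 2 / 2) (𝓝[>] 0) (𝓝 (c : ℝ)) := by
    have : Continuous fun s : ℝ => (c : ℝ) + c ^ 2 * s ^ 2 / 2 := by fun_prop
    simpa using (this.tendsto 0).mono_left nhdsWithin_le_nhds
  have hsmall : ∀ᶠ s : ℝ in 𝓝[>] 0, (c : ℝ) * s ^ 2 / 2 ≤ 1 := by
    have : Continuous fun s : ℝ => (c : ℝ) * s ^ 2 / 2 := by fun_prop
    have h0 := (this.tendsto 0).mono_left (nhdsWithin_le_nhds (s := Set.Ioi 0))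
    exact h0.eventually_le_const (by norm_num)
  refine ge_of_tendsto hlim ?_
  filter_upwards [hsmall, self_mem_nhdsWithin] with s hs1 hs
  exact hbound s hs hs1

/-- The even moments of a sub-Gaussian random variable. -/
lemma ProbabilityTheory.HasSubgaussianMGF.lintegral_pow_le {X : Ω → ℝ} {c : ℝ≥0}
    (h : HasSubgaussianMGF X c P) (hc : 0 < c) (k : ℕ) :
    ∫⁻ ω, ENNReal.ofReal (X ω ^ (2 * k)) ∂P ≤
      ENNReal.ofReal ((2 * k).factorial * (2 * Real.exp (1 / 2)) * (c : ℝ) ^ k) := by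
  -- With s = c^{−1/2} the bound e^{cs²/2} becomes e^{1/2}. The pointwise inequality is y^{2k} ≤
  -- (2k)! e^{|y|} at y = sx.
  set s : ℝ := (Real.sqrt c)⁻¹
  have hc' : (0 : ℝ) < c := hc
  have hs : 0 < s := inv_pos.2 (Real.sqrt_pos.2 hc')
  have hs2 : s ^ 2 = (c : ℝ)⁻¹ := by rw [inv_pow, Real.sq_sqrt hc'.le]
  have hpt : ∀ x : ℝ, x ^ (2 * k) ≤ (2 * k).factorial * (c : ℝ) ^ k *
      (Real.exp (s * x) + Real.exp (-s * x)) := by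
    intro x
    have h1 := Real.pow_div_factorial_le_exp |s * x| (abs_nonneg _) (2 * k)
    have h2 : Real.exp |s * x| ≤ Real.exp (s * x) + Real.exp (-s * x) := by
      rcases abs_cases (s * x) with ⟨h, _⟩ | ⟨h, _⟩ <;> rw [h]
      · linarith [Real.exp_pos (-s * x)]
      · rw [neg_mul]; linarith [Real.exp_pos (s * x)]
    have h3 : |s * x| ^ (2 * k) = ((c : ℝ) ^ k)⁻¹ * x ^ (2 * k) := by
      rw [(even_two_mul k).pow_abs, mul_pow, pow_mul s, hs2, inv_pow]
    rw [h3, div_le_iff₀ (by positivity)] at h1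
    calc x ^ (2 * k) = (c : ℝ) ^ k * (((c : ℝ) ^ k)⁻¹ * x ^ (2 * k)) := by field_simp
      _ ≤ (c : ℝ) ^ k * ((Real.exp (s * x) + Real.exp (-s * x)) * (2 * k).factorial) := by
          refine mul_le_mul_of_nonneg_left (h1.trans ?_) (by positivity)
          gcongr
      _ = _ := by ring
  have hint : Integrable (fun ω => (2 * k).factorial * (c : ℝ) ^ k *
      (Real.exp (s * X ω) + Real.exp (-s * X ω))) P :=
    ((h.integrable_exp_mul s).add (h.integrable_exp_mul (-s))).const_mul
    ((2 * k).factorial * (c : ℝ) ^ k)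
  calc _ ≤ ∫⁻ ω, ENNReal.ofReal ((2 * k).factorial * (c : ℝ) ^ k *
        (Real.exp (s * X ω) + Real.exp (-s * X ω))) ∂P :=
        lintegral_mono fun ω => ENNReal.ofReal_le_ofReal (hpt _)
    _ = ENNReal.ofReal (∫ ω, (2 * k).factorial * (c : ℝ) ^ k *
        (Real.exp (s * X ω) + Real.exp (-s * X ω)) ∂P) :=
        (ofReal_integral_eq_lintegral_ofReal hint (ae_of_all _ fun ω => by positivity)).symm
    _ ≤ _ := by
        refine ENNReal.ofReal_le_ofReal ?_
        rw [integral_const_mul, integral_add (h.integrable_exp_mul s) (h.integrable_exp_mul (-s))]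
        have h2 := h.mgf_le s
        have h3 := h.mgf_le (-s)
        simp only [mgf, neg_sq, hs2, mul_inv_cancel₀ hc'.ne'] at h2 h3
        calc _ ≤ (2 * k).factorial * (c : ℝ) ^ k * (Real.exp (1 / 2) + Real.exp (1 / 2)) := by
              gcongr
          _ = _ := by ring

/-! ### Elementary stochastic integrals -/

/-- The squared norm of a step function in `L²((0, T])`. -/
def StepData.sqNorm {T : ℝ≥0} (s : StepData T) : ℝ≥0 :=
  ∑ i : Fin s.n, ‖s.vals i‖₊ ^ 2 * (s.pts i.succ - s.pts i.castSucc)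

lemma StepData.measurable_toFun {T : ℝ≥0} (s : StepData T) : Measurable s.toFun := by
  unfold StepData.toFun
  exact Finset.measurable_fun_sum _ fun i _ => measurable_const.indicator measurableSet_Ioc

lemma StepData.toFun_of_mem {T : ℝ≥0} (s : StepData T) {u : ℝ} {i : Fin s.n}
    (hi : u ∈ Set.Ioc (s.pts i.castSucc : ℝ) (s.pts i.succ : ℝ)) :
    s.toFun u = s.vals i ∧ ∀ j, j ≠ i →
      u ∉ Set.Ioc (s.pts j.castSucc : ℝ) (s.pts j.succ : ℝ) := by
  have hj : ∀ j, j ≠ i → u ∉ Set.Ioc (s.pts j.castSucc : ℝ) (s.pts j.succ : ℝ) := by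
    intro j hj hu
    rcases lt_or_gt_of_ne hj with h | h
    · have : s.pts j.succ ≤ s.pts i.castSucc := s.mono (Fin.le_def.2 (by simpa using h))
      have : (s.pts j.succ : ℝ) ≤ s.pts i.castSucc := this
      linarith [hu.2, hi.1]
    · have : s.pts i.succ ≤ s.pts j.castSucc := s.mono (Fin.le_def.2 (by simpa using h))
      have : (s.pts i.succ : ℝ) ≤ s.pts j.castSucc := this
      linarith [hu.1, hi.2]
  refine ⟨?_, hj⟩
  rw [StepData.toFun, Finset.sum_eq_single i, Set.indicator_of_mem hi]
  · exact fun j _ hji => Set.indicator_of_notMem (hj j hji) _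
  · simp

/-- The intervals are disjoint, so at most one summand is active at each point and the square has no
cross terms. -/
lemma StepData.sqNorm_le {T : ℝ≥0} (s : StepData T) :
    (s.sqNorm : ℝ≥0∞) ≤ (eLpNorm s.toFun 2 (volume.restrict (Set.Ioc (0 : ℝ) T))) ^ 2 := by
  have h1 : (eLpNorm s.toFun 2 (volume.restrict (Set.Ioc (0 : ℝ) T))) ^ 2 =
      ∫⁻ u in Set.Ioc (0 : ℝ) T, ‖s.toFun u‖ₑ ^ 2 := by
    have := eLpNorm_nnreal_pow_eq_lintegral (f := s.toFun) (p := 2)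
      (μ := volume.restrict (Set.Ioc (0 : ℝ) T)) (by norm_num)
    simpa using this
  have h2 : ∀ u, ∑ i : Fin s.n, Set.indicator
      (Set.Ioc (s.pts i.castSucc : ℝ) (s.pts i.succ : ℝ)) (fun _ => ‖s.vals i‖ₑ ^ 2) u ≤
      ‖s.toFun u‖ₑ ^ 2 := by
    intro u
    by_cases hu : ∃ i, u ∈ Set.Ioc (s.pts (Fin.castSucc i) : ℝ) (s.pts (Fin.succ i) : ℝ)
    · obtain ⟨i, hi⟩ := hu
      obtain ⟨e, hj⟩ := s.toFun_of_mem hi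
      rw [e, Finset.sum_eq_single i, Set.indicator_of_mem hi]
      · exact fun j _ hji => Set.indicator_of_notMem (hj j hji) _
      · simp
    · push Not at hu
      rw [Finset.sum_eq_zero fun i _ => Set.indicator_of_notMem (hu i) _]
      exact zero_le
  rw [h1]
  refine le_trans (le_of_eq ?_) (lintegral_mono h2)
  rw [lintegral_finsetSum _ fun i _ => measurable_const.indicator measurableSet_Ioc,
    StepData.sqNorm, ENNReal.ofNNReal_finsetSum]
  refine Finset.sum_congr rfl fun i _ => ?_
  have hsub : Set.Ioc (s.pts i.castSucc : ℝ) (s.pts i.succ : ℝ) ⊆ Set.Ioc 0 (T : ℝ) := by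
    have h : s.pts i.succ ≤ s.pts (Fin.last s.n) := s.mono (Fin.le_last _)
    rw [s.last] at h
    exact Set.Ioc_subset_Ioc (NNReal.coe_nonneg _) (NNReal.coe_le_coe.2 h)
  have hle : s.pts i.castSucc ≤ s.pts i.succ := s.mono (Fin.castSucc_le_succ i)
  rw [lintegral_indicator_const measurableSet_Ioc, Measure.restrict_apply measurableSet_Ioc,
    Set.inter_eq_left.2 hsub, Real.volume_Ioc, ← NNReal.coe_sub hle, ENNReal.ofReal_coe_nnreal,
    ENNReal.coe_mul, ENNReal.coe_pow]
  rfl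

lemma StepData.hasSubgaussianMGF_integral {T : ℝ≥0} (s : StepData T) {B : ℝ≥0 → Ω → ℝ}
    (hB : IsPreBrownianReal B P) : HasSubgaussianMGF (s.integral B) s.sqNorm P := by
  have hind := (hB.hasIndepIncrements s.n s.pts s.mono).comp (fun i x => s.vals i * x)
    (fun i => by fun_prop)
  have := HasSubgaussianMGF.sum_of_iIndepFun hind (s := Finset.univ)
    (c := fun i => ‖s.vals i‖₊ ^ 2 * (s.pts i.succ - s.pts i.castSucc)) fun i _ => ?_
  · exact this
  have hle : s.pts i.castSucc ≤ s.pts i.succ := s.mono (Fin.castSucc_le_succ i)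
  have h1 := (hasSubgaussianMGF_of_hasLaw_gaussianReal
    (hB.hasLaw_sub (s.pts i.succ) (s.pts i.castSucc))).const_mul (s.vals i)
  refine HasSubgaussianMGF.of_le h1 (le_of_eq ?_)
  apply NNReal.coe_injective
  change s.vals i ^ 2 * dist (s.pts i.succ : ℝ) (s.pts i.castSucc : ℝ) = _
  rw [NNReal.coe_mul, NNReal.coe_sub hle]
  have : (s.pts i.castSucc : ℝ) ≤ s.pts i.succ := hle
  simp [Real.dist_eq, abs_of_nonneg (sub_nonneg.2 this)]

end SubGaussian

/-! ### A Kolmogorov continuity theorem -/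

section Kolmogorov

variable {Ω T : Type*} [MetricSpace T]

open Classical in
/-- Pairs of points that are close at the scale `2 ^ (-n)`. -/
def closePairs (F : ℕ → Finset T) (n : ℕ) : Finset (T × T) :=
  ((F n ∪ F (n + 1)) ×ˢ (F n ∪ F (n + 1))).filter fun p => dist p.1 p.2 ≤ 5 * (1 / 2 : ℝ) ^ n

/-- The weighted sum of the moments of all increments over close pairs. -/
def chainingSum (X : T → Ω → ℝ) (F : ℕ → Finset T) (k : ℕ) (γ : ℝ) (ω : Ω) : ℝ≥0∞ :=
  ∑' n, ∑ p ∈ closePairs F n,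
    ENNReal.ofReal (((2 : ℝ) ^ (γ * n) * (X p.1 ω - X p.2 ω)) ^ (2 * k))

/-- Finiteness of the chaining sum controls all increments over close pairs. -/
lemma exists_increment_bound {X : T → Ω → ℝ} {F : ℕ → Finset T} {k : ℕ} (hk : k ≠ 0) {γ : ℝ}
    {ω : Ω} (h : chainingSum X F k γ ω < ∞) :
    ∃ K : ℝ, 0 ≤ K ∧ ∀ n, ∀ p ∈ closePairs F n,
      |X p.1 ω - X p.2 ω| ≤ K * ((2 : ℝ) ^ (-γ)) ^ n := by
  set S := (chainingSum X F k γ ω).toReal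
  -- Since S ≤ (max 1 S)^{2k}, the constant max 1 S replaces the root S^{1/(2k)}.
  refine ⟨max 1 S, by positivity, fun n p hp => ?_⟩
  have h1 : ENNReal.ofReal (((2 : ℝ) ^ (γ * n) * (X p.1 ω - X p.2 ω)) ^ (2 * k)) ≤
      chainingSum X F k γ ω :=
    (Finset.single_le_sum (f := fun p : T × T => ENNReal.ofReal
      (((2 : ℝ) ^ (γ * n) * (X p.1 ω - X p.2 ω)) ^ (2 * k))) (fun _ _ => zero_le) hp).trans
      (ENNReal.le_tsum n)
  have h2 : ((2 : ℝ) ^ (γ * n) * (X p.1 ω - X p.2 ω)) ^ (2 * k) ≤ S :=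
    (ENNReal.ofReal_le_iff_le_toReal h.ne).1 h1
  have h3 : |(2 : ℝ) ^ (γ * n) * (X p.1 ω - X p.2 ω)| ^ (2 * k) ≤ (max 1 S) ^ (2 * k) := by
    rw [(even_two_mul k).pow_abs]
    exact h2.trans ((le_max_right 1 S).trans
      (le_self_pow₀ (le_max_left 1 S) (by omega)))
  have h4 := (pow_le_pow_iff_left₀ (abs_nonneg _) (by positivity) (by omega)).1 h3
  have h2n : (0 : ℝ) < 2 ^ (γ * n) := by positivity
  rw [abs_mul, abs_of_pos h2n] at h4
  have e : ((2 : ℝ) ^ (-γ)) ^ n = (2 ^ (γ * n))⁻¹ := by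
    rw [← Real.rpow_mul_natCast (by norm_num), neg_mul, Real.rpow_neg (by norm_num)]
  rw [e, ← div_eq_mul_inv, le_div_iff₀ h2n, mul_comm]
  exact h4

variable [MeasurableSpace Ω] {P : Measure Ω}

lemma measurable_chainingSum {X : T → Ω → ℝ} (hX : ∀ x, Measurable (X x)) (F : ℕ → Finset T)
    (k : ℕ) (γ : ℝ) : Measurable (chainingSum X F k γ) := by
  unfold chainingSum
  refine Measurable.tsum fun n => Finset.measurable_fun_sum _ fun p _ => ?_
  have h1 := hX p.1
  have h2 := hX p.2
  fun_prop

lemma card_closePairs_le {F : ℕ → Finset T} {q : ℕ} (hF : ∀ n, (F n).card ≤ 2 ^ (q * (n + 1)))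
    (n : ℕ) : (closePairs F n).card ≤ 2 ^ (2 * (q * (n + 2) + 1)) := by
  classical
  have h1 : (F n ∪ F (n + 1)).card ≤ 2 ^ (q * (n + 2) + 1) := by
    refine (Finset.card_union_le _ _).trans ?_
    rw [pow_succ, mul_two]
    exact add_le_add ((hF n).trans (Nat.pow_le_pow_right two_pos (by nlinarith))) (hF (n + 1))
  refine (Finset.card_filter_le _ _).trans ?_
  rw [Finset.card_product, two_mul, pow_add]
  exact Nat.mul_le_mul h1 h1

/-- At scale n there are of order 2^{2qn} close pairs, each with expected contribution of order
2^{2k(γ−β)n}. The condition `hk` leaves a factor 2^{−n}. -/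
lemma lintegral_chainingSum_lt_top {X : T → Ω → ℝ} (hX : ∀ x, Measurable (X x))
    {F : ℕ → Finset T} {q : ℕ} (hF : ∀ n, (F n).card ≤ 2 ^ (q * (n + 1))) {β γ M : ℝ} {k : ℕ}
    (hβ : 0 ≤ β) (hM : 0 ≤ M) (hk : 2 * q + 1 ≤ 2 * k * (β - γ))
    (hmom : ∀ x y, ∫⁻ ω, ENNReal.ofReal ((X x ω - X y ω) ^ (2 * k)) ∂P ≤
      ENNReal.ofReal (M * dist x y ^ (2 * k * β))) :
    ∫⁻ ω, chainingSum X F k γ ω ∂P < ∞ := by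
  have hmeas : ∀ (n : ℕ) (p : T × T), Measurable fun ω =>
      ENNReal.ofReal (((2 : ℝ) ^ (γ * n) * (X p.1 ω - X p.2 ω)) ^ (2 * k)) := by
    intro n p
    have h1 := hX p.1
    have h2 := hX p.2
    fun_prop
  set D : ℝ := 2 ^ (4 * q + 2) * M * 5 ^ (2 * k * β) with hD
  have hD0 : 0 ≤ D := by positivity
  have hterm : ∀ n : ℕ, ∀ p ∈ closePairs F n,
      ∫⁻ ω, ENNReal.ofReal (((2 : ℝ) ^ (γ * n) * (X p.1 ω - X p.2 ω)) ^ (2 * k)) ∂P ≤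
      ENNReal.ofReal (((2 : ℝ) ^ (γ * n)) ^ (2 * k) *
        (M * (5 * (1 / 2 : ℝ) ^ n) ^ (2 * k * β))) := by
    intro n p hp
    have hd := (Finset.mem_filter.1 hp).2
    have h0 : (0 : ℝ) ≤ ((2 : ℝ) ^ (γ * n)) ^ (2 * k) := by positivity
    simp only [mul_pow, ENNReal.ofReal_mul h0]
    have hm : Measurable fun ω => ENNReal.ofReal ((X p.1 ω - X p.2 ω) ^ (2 * k)) := by
      have h1 := hX p.1
      have h2 := hX p.2
      fun_prop
    rw [lintegral_const_mul _ hm]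
    gcongr
    refine (hmom p.1 p.2).trans (ENNReal.ofReal_le_ofReal ?_)
    gcongr
  have hn : ∀ n : ℕ, ∑ p ∈ closePairs F n,
      ∫⁻ ω, ENNReal.ofReal (((2 : ℝ) ^ (γ * n) * (X p.1 ω - X p.2 ω)) ^ (2 * k)) ∂P ≤
      ENNReal.ofReal (D * (1 / 2) ^ n) := by
    intro n
    refine (Finset.sum_le_card_nsmul _ _ _ (hterm n)).trans ?_
    rw [nsmul_eq_mul, ← ENNReal.ofReal_natCast, ← ENNReal.ofReal_mul (by positivity)]
    refine ENNReal.ofReal_le_ofReal ?_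
    have hcard : ((closePairs F n).card : ℝ) ≤ 2 ^ (2 * (q * (n + 2) + 1)) := by
      exact_mod_cast card_closePairs_le hF n
    have e1 : ((2 : ℝ) ^ (γ * n)) ^ (2 * k) = 2 ^ (2 * k * γ * n) := by
      rw [← Real.rpow_mul_natCast (by norm_num)]; congr 1; push_cast; ring
    have e2 : (5 * (1 / 2 : ℝ) ^ n) ^ (2 * k * β) = 5 ^ (2 * k * β) * 2 ^ (-(2 * k * β * n)) := by
      rw [Real.mul_rpow (by norm_num) (by positivity), ← Real.rpow_natCast_mul (by norm_num),
        one_div, Real.inv_rpow (by norm_num), ← Real.rpow_neg (by norm_num)]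
      congr 2; ring
    have e3 : (2 : ℝ) ^ (2 * (q * (n + 2) + 1)) = 2 ^ (4 * q + 2) * 2 ^ ((2 * q * n : ℝ)) := by
      rw [show 2 * (q * (n + 2) + 1) = (4 * q + 2) + 2 * q * n by ring, pow_add]
      congr 1
      rw [← Real.rpow_natCast]; push_cast; rfl
    have e4 : (2 : ℝ) ^ (2 * q * n : ℝ) * (2 ^ (2 * k * γ * n) * 2 ^ (-(2 * k * β * n))) ≤
        (1 / 2) ^ n := by
      rw [← Real.rpow_add (by norm_num), ← Real.rpow_add (by norm_num), one_div, inv_pow,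
        ← Real.rpow_natCast, ← Real.rpow_neg (by norm_num)]
      refine Real.rpow_le_rpow_of_exponent_le (by norm_num) ?_
      have hn0 : (0 : ℝ) ≤ n := n.cast_nonneg
      nlinarith [mul_le_mul_of_nonneg_right hk hn0]
    rw [e1, e2]
    calc _ ≤ 2 ^ (2 * (q * (n + 2) + 1)) * ((2 : ℝ) ^ (2 * k * γ * n) *
          (M * (5 ^ (2 * k * β) * 2 ^ (-(2 * k * β * n))))) := by gcongr
      _ = D * (2 ^ (2 * q * n : ℝ) * (2 ^ (2 * k * γ * n) * 2 ^ (-(2 * k * β * n)))) := by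
          rw [e3, hD]; ring
      _ ≤ _ := by gcongr
  unfold chainingSum
  rw [lintegral_tsum fun n => (Finset.measurable_fun_sum _ fun p _ => hmeas n p).aemeasurable]
  simp only [lintegral_finsetSum _ fun p _ => hmeas _ p]
  refine (ENNReal.tsum_le_tsum hn).trans_lt ?_
  rw [← ENNReal.ofReal_tsum_of_nonneg (fun n => by positivity)
    ((summable_geometric_of_lt_one (by norm_num) (by norm_num)).mul_left D)]
  exact ENNReal.ofReal_lt_top

variable [MeasurableSpace T] [MeasurableSingletonClass T]

/-- A **Kolmogorov continuity theorem** for processes with all moments, indexed by a metric space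
with nets of polynomial size. -/
theorem exists_holder_modification {X : T → Ω → ℝ} (hX : ∀ x, Measurable (X x)) {β : ℝ}
    (hβ : 0 < β)
    (hmom : ∀ k : ℕ, k ≠ 0 → ∃ M : ℝ, 0 ≤ M ∧ ∀ x y,
      ∫⁻ ω, ENNReal.ofReal ((X x ω - X y ω) ^ (2 * k)) ∂P ≤
        ENNReal.ofReal (M * dist x y ^ (2 * k * β)))
    {r : ℕ → T → T} (hr : ∀ n, Measurable (r n)) {F : ℕ → Finset T} (hrF : ∀ n x, r n x ∈ F n)
    {q : ℕ} (hF : ∀ n, (F n).card ≤ 2 ^ (q * (n + 1)))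
    (hdist : ∀ n x, dist (r n x) x ≤ 2 * (1 / 2 : ℝ) ^ n) :
    ∃ V : T → Ω → ℝ, Measurable (Function.uncurry V) ∧ (∀ x, V x =ᵐ[P] X x) ∧
      ∀ ω γ, 0 < γ → γ < β → ∃ K : ℝ, ∀ x y, dist x y ≤ 1 →
        |V x ω - V y ω| ≤ K * dist x y ^ γ := by
  classical
  -- Countably many orders in (0, β) tending to β: one almost sure event then serves all γ < β at
  -- once.
  set g : ℕ → ℝ := fun j => β - β / (j + 2) with hg
  have hgβ : ∀ j, g j < β := fun j => by
    have : 0 < β / (j + 2) := by positivity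
    simp only [hg]; linarith
  have hg0 : ∀ j, 0 < g j := fun j => by
    have : β / (j + 2) < β := by
      rw [div_lt_iff₀ (by positivity)]
      have : (0 : ℝ) ≤ j := j.cast_nonneg
      nlinarith
    simp only [hg]; linarith
  have hexk : ∀ j, ∃ k : ℕ, k ≠ 0 ∧ 2 * (q : ℝ) + 1 ≤ 2 * k * (β - g j) := by
    intro j
    have hpos : 0 < β - g j := by linarith [hgβ j]
    obtain ⟨k, hk⟩ := exists_nat_ge ((2 * (q : ℝ) + 1) / (β - g j))
    rw [div_le_iff₀ hpos] at hk
    refine ⟨k + 1, by omega, ?_⟩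
    push_cast
    have : (0 : ℝ) ≤ k * (β - g j) := by positivity
    nlinarith
  choose k hk0 hk using hexk
  set G : Set Ω := {ω | ∀ j, chainingSum X F (k j) (g j) ω < ∞} with hG
  have hGm : MeasurableSet G := by
    rw [hG, Set.ofPred_forall]
    exact MeasurableSet.iInter fun j =>
      measurable_chainingSum hX F (k j) (g j) measurableSet_Iio
  have hGae : ∀ᵐ ω ∂P, ω ∈ G := by
    rw [hG]
    refine ae_all_iff.2 fun j => ?_
    obtain ⟨M, hM, hMom⟩ := hmom (k j) (hk0 j)
    exact ae_lt_top (measurable_chainingSum hX F _ _)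
      (lintegral_chainingSum_lt_top hX hF hβ.le hM (hk j) hMom).ne
  have hpair1 : ∀ n x, (r n x, r (n + 1) x) ∈ closePairs F n := by
    intro n x
    refine Finset.mem_filter.2 ⟨Finset.mem_product.2 ⟨Finset.mem_union_left _ (hrF n x),
      Finset.mem_union_right _ (hrF (n + 1) x)⟩, ?_⟩
    have h1 := hdist n x
    have h2 := hdist (n + 1) x
    have h3 := dist_triangle_right (r n x) (r (n + 1) x) x
    rw [pow_succ] at h2
    have : (0 : ℝ) < (1 / 2) ^ n := by positivity
    simp only
    linarith
  -- This is the source of the constant 5 in `closePairs`: 2 + 1 + 2 in units of 2^{−n}.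
  have hpair2 : ∀ n x y, dist x y ≤ (1 / 2 : ℝ) ^ n → (r n x, r n y) ∈ closePairs F n := by
    intro n x y hxy
    refine Finset.mem_filter.2 ⟨Finset.mem_product.2 ⟨Finset.mem_union_left _ (hrF n x),
      Finset.mem_union_left _ (hrF n y)⟩, ?_⟩
    have h1 := hdist n x
    have h2 := hdist n y
    have h3 := dist_triangle4 (r n x) x y (r n y)
    rw [dist_comm y] at h3
    simp only
    linarith
  have hlt1 : ∀ γ : ℝ, 0 < γ → (2 : ℝ) ^ (-γ) < 1 := fun γ hγ =>
    Real.rpow_lt_one_of_one_lt_of_neg (by norm_num) (by linarith)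
  -- Setting the approximations to 0 off the good event makes them converge for every ω, so all
  -- paths of the limit are Hölder.
  set Y : ℕ → T → Ω → ℝ := fun n x => G.indicator (X (r n x)) with hY
  have hYin : ∀ n x ω, ω ∈ G → Y n x ω = X (r n x) ω := fun n x ω h =>
    Set.indicator_of_mem h _
  have hstep : ∀ j ω, ω ∈ G → ∃ K : ℝ, 0 ≤ K ∧
      (∀ x n, dist (Y n x ω) (Y (n + 1) x ω) ≤ K * ((2 : ℝ) ^ (-g j)) ^ n) ∧
      ∀ n x y, dist x y ≤ (1 / 2 : ℝ) ^ n →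
        |Y n x ω - Y n y ω| ≤ K * ((2 : ℝ) ^ (-g j)) ^ n := by
    intro j ω hω
    obtain ⟨K, hK0, hK⟩ := exists_increment_bound (hk0 j) (hω j)
    refine ⟨K, hK0, fun x n => ?_, fun n x y hxy => ?_⟩
    · rw [hYin _ _ _ hω, hYin _ _ _ hω, Real.dist_eq]
      exact hK n _ (hpair1 n x)
    · rw [hYin _ _ _ hω, hYin _ _ _ hω]
      exact hK n _ (hpair2 n x y hxy)
  have hlim : ∀ x ω, ∃ v, Tendsto (fun n => Y n x ω) atTop (𝓝 v) := by
    intro x ω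
    by_cases hω : ω ∈ G
    · obtain ⟨K, -, hK, -⟩ := hstep 0 ω hω
      exact cauchySeq_tendsto_of_complete
        (cauchySeq_of_le_geometric _ K (hlt1 _ (hg0 0)) (hK x))
    · exact ⟨0, by simp [hY, Set.indicator_of_notMem hω]⟩
  choose V hV using hlim
  refine ⟨V, ?_, fun x => ?_, fun ω γ hγ hγβ => ?_⟩
  · refine measurable_of_tendsto_metrizable (f := fun n (p : T × Ω) => Y n p.1 p.2)
      (fun n => ?_) (tendsto_pi_nhds.2 fun p => hV p.1 p.2)
    -- Joint measurability: `r n` takes finitely many values, so Y is a finite sum of products of a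
    -- function of the point and a function of ω.
    have e : (fun p : T × Ω => Y n p.1 p.2) = fun p : T × Ω => ∑ u ∈ F n,
        ({p : T × Ω | r n p.1 = u}).indicator (fun p => G.indicator (X u) p.2) p := by
      funext p
      rw [Finset.sum_eq_single (r n p.1), Set.indicator_of_mem (by simp)]
      · exact fun u _ hu => Set.indicator_of_notMem (fun h => hu h.symm) _
      · exact fun h => absurd (hrF n p.1) h
    rw [e]
    refine Finset.measurable_fun_sum _ fun u _ => ?_
    refine Measurable.indicator (((hX u).indicator hGm).comp measurable_snd) ?_
    exact (((hr n).comp measurable_fst) (measurableSet_singleton u))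
  · obtain ⟨M, hM, hMom⟩ := hmom 1 one_ne_zero
    have hVm : Measurable (V x) :=
      measurable_of_tendsto_metrizable (fun n => (hX (r n x)).indicator hGm)
        (tendsto_pi_nhds.2 fun ω => hV x ω)
    -- Fatou's lemma with the second moment bound, as `r n x` tends to x.
    have hzero : ∫⁻ ω, ENNReal.ofReal ((V x ω - X x ω) ^ (2 * 1)) ∂P ≤ 0 := by
      calc ∫⁻ ω, ENNReal.ofReal ((V x ω - X x ω) ^ (2 * 1)) ∂P
          = ∫⁻ ω, liminf (fun n => ENNReal.ofReal ((X (r n x) ω - X x ω) ^ (2 * 1))) atTop ∂P := by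
            refine lintegral_congr_ae ?_
            filter_upwards [hGae] with ω hω
            refine (Tendsto.liminf_eq ?_).symm
            refine ENNReal.tendsto_ofReal (((Tendsto.sub_const ?_ _)).pow _)
            simpa only [hYin _ _ _ hω] using hV x ω
        _ ≤ liminf (fun n => ∫⁻ ω, ENNReal.ofReal ((X (r n x) ω - X x ω) ^ (2 * 1)) ∂P) atTop := by
            refine lintegral_liminf_le fun n => ?_
            have h1 := hX (r n x)
            have h2 := hX x
            fun_prop
        _ ≤ liminf (fun n : ℕ => ENNReal.ofReal (M * (2 * (1 / 2 : ℝ) ^ n) ^ (2 * β))) atTop := by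
            refine liminf_le_liminf (Eventually.of_forall fun n => (hMom _ _).trans ?_)
            refine ENNReal.ofReal_le_ofReal ?_
            simp only [Nat.cast_one, mul_one]
            have := hdist n x
            gcongr
        _ = 0 := by
            refine Tendsto.liminf_eq ?_
            have h1 : Tendsto (fun n : ℕ => 2 * (1 / 2 : ℝ) ^ n) atTop (𝓝 0) := by
              simpa using (tendsto_pow_atTop_nhds_zero_of_lt_one (r := (1 / 2 : ℝ))
                (by norm_num) (by norm_num)).const_mul 2
            have h2 := (h1.rpow_const (p := 2 * β) (Or.inr (by linarith))).const_mul M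
            rw [Real.zero_rpow (by linarith), mul_zero] at h2
            simpa using ENNReal.tendsto_ofReal h2
    have hm : Measurable fun ω => ENNReal.ofReal ((V x ω - X x ω) ^ (2 * 1)) := by
      have h2 := hX x
      fun_prop
    filter_upwards [(lintegral_eq_zero_iff hm).1 (le_antisymm hzero zero_le)] with ω hω
    have h1 : (V x ω - X x ω) ^ (2 * 1) ≤ 0 := ENNReal.ofReal_eq_zero.1 hω
    have h2 : V x ω - X x ω = 0 := by
      refine (pow_eq_zero_iff two_ne_zero).1 (le_antisymm (by simpa using h1) (sq_nonneg _))
    linarith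
  · by_cases hω : ω ∈ G
    · obtain ⟨j, hj⟩ : ∃ j : ℕ, γ ≤ g j := by
        obtain ⟨j, hj⟩ := exists_nat_ge (β / (β - γ))
        refine ⟨j, ?_⟩
        have hpos : 0 < β - γ := by linarith
        rw [div_le_iff₀ hpos] at hj
        have : β / (j + 2) ≤ β - γ := by
          rw [div_le_iff₀ (by positivity)]
          nlinarith
        simp only [hg]; linarith
      obtain ⟨K, hK0, hK1, hK2⟩ := hstep j ω hω
      set ρ : ℝ := (2 : ℝ) ^ (-g j) with hρ
      have hρ1 : ρ < 1 := hlt1 _ (hg0 j)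
      have hρ0 : 0 < ρ := by positivity
      -- Two geometric chaining tails, one for each endpoint, and one link between the net points at
      -- the scale 2^{−n} comparable to the distance.
      set K' : ℝ := K / (1 - ρ) + K / (1 - ρ) + K with hK'
      have hK'0 : 0 ≤ K' := by
        have : 0 < 1 - ρ := by linarith
        positivity
      refine ⟨K' * 2 ^ γ, fun x y hxy => ?_⟩
      rcases eq_or_ne x y with rfl | hne
      · simp [Real.zero_rpow hγ.ne']
      obtain ⟨n, hn1, hn2⟩ := exists_nat_pow_near_of_lt_one (dist_pos.2 hne) hxy
        (show (0 : ℝ) < 1 / 2 by norm_num) (by norm_num)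
      have h1 := dist_le_of_le_geometric_of_tendsto ρ K hρ1 (hK1 x) (hV x ω) n
      have h2 := dist_le_of_le_geometric_of_tendsto ρ K hρ1 (hK1 y) (hV y ω) n
      have h3 := hK2 n x y hn2
      have h4 : |V x ω - V y ω| ≤ K' * ρ ^ n := by
        rw [Real.dist_eq, abs_sub_comm] at h1
        rw [Real.dist_eq] at h2
        have e : V x ω - V y ω = (V x ω - Y n x ω) + (Y n y ω - V y ω) + (Y n x ω - Y n y ω) := by
          ring
        rw [e]
        refine (abs_add_three _ _ _).trans ?_
        refine (add_le_add (add_le_add h1 h2) h3).trans (le_of_eq ?_)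
        rw [hK']; ring
      have h5 : ρ ^ n ≤ 2 ^ γ * dist x y ^ γ := by
        rw [← Real.mul_rpow (by norm_num) dist_nonneg]
        calc ρ ^ n = ((1 / 2 : ℝ) ^ n) ^ g j := by
              rw [hρ, ← Real.rpow_mul_natCast (by norm_num), ← Real.rpow_natCast_mul (by norm_num),
                one_div, Real.inv_rpow (by norm_num), ← Real.rpow_neg (by norm_num)]
              congr 1; ring
          _ ≤ ((1 / 2 : ℝ) ^ n) ^ γ := by
              refine Real.rpow_le_rpow_of_exponent_ge (by positivity) ?_ hj
              exact pow_le_one₀ (by norm_num) (by norm_num)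
          _ ≤ _ := by
              rw [pow_succ] at hn1
              gcongr
              linarith
      calc _ ≤ K' * ρ ^ n := h4
        _ ≤ K' * (2 ^ γ * dist x y ^ γ) := by gcongr
        _ = _ := by ring
    · have hV0 : ∀ x, V x ω = 0 := fun x => by
        have := hV x ω
        simp only [hY, Set.indicator_of_notMem hω] at this
        exact tendsto_nhds_unique this tendsto_const_nhds
      refine ⟨0, fun x y _ => ?_⟩
      simp [hV0]

end Kolmogorov

/-! ### Nets on the sphere and the two distances -/

/-- The cell of the cubic grid of mesh `2 ^ (-n)` that contains a point. -/
def gridCell (n : ℕ) (x : Sphere2) : Fin 3 → ℤ := fun i => ⌊(2 : ℝ) ^ n * x.1 i⌋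

instance nonempty_sphere2 : Nonempty Sphere2 :=
  ⟨⟨!₂[0, 0, 1], by simp [EuclideanSpace.norm_eq, Fin.sum_univ_three]⟩⟩

/-- A point of the sphere in the same grid cell. -/
def gridPoint (n : ℕ) (x : Sphere2) : Sphere2 := Function.invFun (gridCell n) (gridCell n x)

lemma gridCell_gridPoint (n : ℕ) (x : Sphere2) : gridCell n (gridPoint n x) = gridCell n x :=
  Function.invFun_eq ⟨x, rfl⟩

/-- The map factors through the countable discrete space ℤ³, on which the choice of a representative
is automatically measurable. -/
lemma measurable_gridPoint (n : ℕ) : Measurable (gridPoint n) := by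
  have h : Measurable (gridCell n) := by
    refine measurable_pi_lambda _ fun i => Int.measurable_floor.comp ?_
    have : Measurable fun x : Sphere2 => x.1 i := by fun_prop
    exact this.const_mul _
  exact (Measurable.of_discrete (f := Function.invFun (gridCell n))).comp h

open Classical in
/-- A finite set that contains all `gridPoint n x`. -/
def gridNet (n : ℕ) : Finset Sphere2 :=
  (Finset.Icc (fun _ : Fin 3 => (-2 ^ n : ℤ)) (fun _ => 2 ^ n)).image (Function.invFun (gridCell n))

lemma abs_sphere_apply_le (x : Sphere2) (i : Fin 3) : |x.1 i| ≤ 1 := by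
  have := PiLp.norm_apply_le x.1 i
  simpa using this

lemma gridPoint_mem (n : ℕ) (x : Sphere2) : gridPoint n x ∈ gridNet n := by
  refine Finset.mem_image_of_mem _ (Finset.mem_Icc.2 ⟨fun i => ?_, fun i => ?_⟩)
  · refine Int.le_floor.2 ?_
    have := (abs_le.1 (abs_sphere_apply_le x i)).1
    push_cast
    nlinarith [pow_pos (two_pos (α := ℝ)) n]
  · refine Int.floor_le_iff.2 ?_
    have := (abs_le.1 (abs_sphere_apply_le x i)).2
    push_cast
    nlinarith [pow_pos (two_pos (α := ℝ)) n]

/-- Each axis has 2·2^n + 1 ≤ 2^{2(n+1)} cells. The crude exponent is harmless, since all moments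
are available. -/
lemma card_gridNet_le (n : ℕ) : (gridNet n).card ≤ 2 ^ (6 * (n + 1)) := by
  refine Finset.card_image_le.trans ?_
  rw [Pi.card_Icc]
  simp only [Int.card_Icc, Finset.prod_const, Finset.card_univ, Fintype.card_fin]
  have h : ((2 : ℤ) ^ n + 1 - -2 ^ n).toNat ≤ 2 ^ (2 * (n + 1)) := by
    rw [Int.toNat_le]
    push_cast
    have h1 : (1 : ℤ) ≤ 2 ^ n := one_le_pow₀ (by norm_num)
    have h2 : (2 : ℤ) ^ (2 * (n + 1)) = 4 * (2 ^ n * 2 ^ n) := by ring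
    rw [h2]
    nlinarith
  calc _ ≤ (2 ^ (2 * (n + 1))) ^ 3 := Nat.pow_le_pow_left h 3
    _ = _ := by rw [← pow_mul]; congr 1; ring

lemma dist_gridPoint_le (n : ℕ) (x : Sphere2) : dist (gridPoint n x) x ≤ 2 * (1 / 2 : ℝ) ^ n := by
  have h : ∀ i, |(gridPoint n x).1 i - x.1 i| ≤ (1 / 2 : ℝ) ^ n := by
    intro i
    have h1 := Int.abs_sub_lt_one_of_floor_eq_floor (congrFun (gridCell_gridPoint n x) i)
    rw [← mul_sub, abs_mul, abs_of_pos (by positivity)] at h1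
    rw [one_div, inv_pow, ← one_div, le_div_iff₀ (by positivity), mul_comm]
    exact h1.le
  rw [Subtype.dist_eq, EuclideanSpace.dist_eq, Fin.sum_univ_three]
  refine Real.sqrt_le_iff.2 ⟨by positivity, ?_⟩
  simp only [Real.dist_eq]
  have h0 := pow_le_pow_left₀ (abs_nonneg _) (h 0) 2
  have h1 := pow_le_pow_left₀ (abs_nonneg _) (h 1) 2
  have h2 := pow_le_pow_left₀ (abs_nonneg _) (h 2) 2
  nlinarith

lemma dist_sq_sphere (x y : Sphere2) : dist x y ^ 2 = 2 - 2 * Real.cos (geodesicDist x y) := by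
  have hs1 := abs_le.1 (abs_sphere_inner_le x y)
  rw [geodesicDist, Real.cos_arccos hs1.1 hs1.2, Subtype.dist_eq, dist_eq_norm, norm_sub_sq_real]
  simp
  ring

lemma dist_le_geodesicDist (x y : Sphere2) : dist x y ≤ geodesicDist x y := by
  have h := dist_sq_sphere x y
  have h1 := Real.one_sub_sq_div_two_le_cos (x := geodesicDist x y)
  exact (pow_le_pow_iff_left₀ dist_nonneg (geodesicDist_nonneg x y) two_ne_zero).1 (by linarith)

/-- From cos θ ≤ 1 − 2θ²/π² and π ≤ 4 the squared chord is at least θ²/4. -/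
lemma geodesicDist_le_dist (x y : Sphere2) : geodesicDist x y ≤ 2 * dist x y := by
  have h := dist_sq_sphere x y
  have h0 := geodesicDist_nonneg x y
  have hpi : geodesicDist x y ≤ Real.pi := Real.arccos_le_pi _
  have h1 := Real.cos_le_one_sub_mul_cos_sq (x := geodesicDist x y) (by rwa [abs_of_nonneg h0])
  have h2 : (1 : ℝ) / 8 ≤ 2 / Real.pi ^ 2 := by
    rw [div_le_div_iff₀ (by norm_num) (by positivity)]
    nlinarith [Real.pi_le_four, Real.pi_pos]
  have h3 := mul_le_mul_of_nonneg_right h2 (sq_nonneg (geodesicDist x y))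
  exact (pow_le_pow_iff_left₀ h0 (by positivity) two_ne_zero).1 (by rw [mul_pow]; linarith)

/-! ### Finite sums over the coefficient indices -/

open Classical in
/-- The coefficient indices of degree at most `L`. -/
def coeffFinset (L : ℕ) : Finset CoeffIndex :=
  (Finset.univ ×ˢ Finset.range (L + 1) ×ˢ Finset.range (L + 1)).subtype _

lemma sum_coeffFinset {M : Type*} [AddCommMonoid M] (L : ℕ) (f : Fin 2 → ℕ → ℕ → M) :
    ∑ i ∈ coeffFinset L, f i.1.1 i.1.2.1 i.1.2.2 =
      ∑ l ∈ Finset.range (L + 1), (f 0 l 0 + ∑ m ∈ Finset.Icc 1 l, (f 0 l m + f 1 l m)) := by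
  classical
  have h := Finset.sum_subtype_eq_sum_filter
    (s := (Finset.univ : Finset (Fin 2)) ×ˢ Finset.range (L + 1) ×ˢ Finset.range (L + 1))
    (p := fun p : Fin 2 × ℕ × ℕ => p.2.2 ≤ p.2.1 ∧ (p.1 = 1 → 1 ≤ p.2.2))
    (fun p => f p.1 p.2.1 p.2.2)
  refine h.trans ?_
  rw [Finset.sum_filter, Finset.sum_product, Fin.sum_univ_two, Finset.sum_product,
    Finset.sum_product, ← Finset.sum_add_distrib]
  refine Finset.sum_congr rfl fun l hl => ?_
  have hl' := Finset.mem_range.1 hl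
  simp only [Fin.isValue, zero_ne_one, false_imp_iff, and_true, forall_const]
  rw [← Finset.sum_filter, ← Finset.sum_filter]
  have e1 : (Finset.range (L + 1)).filter (fun m => m ≤ l) = insert 0 (Finset.Icc 1 l) := by
    ext m; simp; omega
  have e2 : (Finset.range (L + 1)).filter (fun m => m ≤ l ∧ 1 ≤ m) = Finset.Icc 1 l := by
    ext m; simp; omega
  rw [e1, e2, Finset.sum_insert (by simp), Finset.sum_add_distrib, add_assoc]

/-- The real spherical harmonics, normalized as in `harmonicPart`. -/
def realSphHarm (j : Fin 2) (l m : ℕ) (x : Sphere2) : ℝ :=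
  if m = 0 then (sphHarm l 0 x).re
  else Real.sqrt 2 * if j = 0 then (sphHarm l m x).re else (sphHarm l m x).im

lemma harmonicPart_eq {Ω : Type*} {c : ℝ} (hc : 0 ≤ c) (coeff : Fin 2 → ℕ → Ω → ℝ) (l : ℕ)
    (x : Sphere2) (ω : Ω) :
    harmonicPart c coeff l x ω =
      Real.sqrt c * realSphHarm 0 l 0 x * coeff 0 0 ω + ∑ m ∈ Finset.Icc 1 l,
        (Real.sqrt c * realSphHarm 0 l m x * coeff 0 m ω +
          Real.sqrt c * realSphHarm 1 l m x * coeff 1 m ω) := by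
  rw [harmonicPart, mul_comm 2 c, Real.sqrt_mul hc, Finset.mul_sum]
  congr 1
  · simp [realSphHarm]; ring
  · refine Finset.sum_congr rfl fun m hm => ?_
    have : m ≠ 0 := by have := (Finset.mem_Icc.1 hm).1; omega
    simp [realSphHarm, this]; ring

lemma sum_sq_realSphHarm_sub (l : ℕ) (x y : Sphere2) :
    (realSphHarm 0 l 0 x - realSphHarm 0 l 0 y) ^ 2 + ∑ m ∈ Finset.Icc 1 l,
      ((realSphHarm 0 l m x - realSphHarm 0 l m y) ^ 2 +
        (realSphHarm 1 l m x - realSphHarm 1 l m y) ^ 2) = sphIncrement l x y := by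
  rw [sphIncrement, Finset.mul_sum]
  congr 1
  refine Finset.sum_congr rfl fun m hm => ?_
  have : m ≠ 0 := by have := (Finset.mem_Icc.1 hm).1; omega
  simp only [realSphHarm, this, if_false, if_true, ← mul_sub, mul_pow, one_ne_zero]
  rw [Real.sq_sqrt zero_le_two]
  ring

/-! ### Wiener integrals of bounded functions -/

section Wiener

variable {Ω : Type*} [MeasurableSpace Ω] {P : Measure Ω}

/-- The zero step function. -/
def StepData.zero (T : ℝ≥0) : StepData T where
  n := 1
  pts := ![0, T]
  vals := 0
  mono := by
    intro i j h
    fin_cases i <;> fin_cases j <;> simp_all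
  first := rfl
  last := rfl

/-- A Wiener integral of a function bounded by `1` is a limit of elementary integrals of step
functions whose norms are asymptotically at most `√T`. -/
lemma wienerIntegral_approx (B : ℝ≥0 → Ω → ℝ) {g : ℝ → ℝ} {T : ℝ≥0} (hg : Measurable g)
    (hb : ∀ u ∈ Set.Ioc (0 : ℝ) T, |g u| ≤ 1) :
    MemLp (wienerIntegral P B g T) 2 P ∧ ∃ s : ℕ → StepData T,
      (∀ n : ℕ, (s n).sqNorm ≤ (1 / (n + 1) + NNReal.sqrt T) ^ 2) ∧
      Tendsto (fun n => eLpNorm (fun ω => (s n).integral B ω - wienerIntegral P B g T ω) 2 P)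
        atTop (𝓝 0) := by
  classical
  by_cases h : ∃ J : Ω → ℝ, IsWienerIntegral P B g T J
  · have hspec := Classical.choose_spec h
    rw [wienerIntegral, dif_pos h]
    set J := Classical.choose h
    have hpos : ∀ n : ℕ, (0 : ℝ) < 1 / (n + 1) := fun n => by positivity
    choose s hs1 hs2 using fun n : ℕ => hspec.2 (1 / (n + 1)) (hpos n)
    refine ⟨hspec.1, s, fun n => ?_, ?_⟩
    · set μ := (volume : Measure ℝ).restrict (Set.Ioc (0 : ℝ) T)
      have hgn : eLpNorm g 2 μ ≤ ((NNReal.sqrt T : ℝ≥0) : ℝ≥0∞) := by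
        have hae : ∀ᵐ u ∂μ, ‖g u‖ ≤ 1 := by
          filter_upwards [ae_restrict_mem measurableSet_Ioc] with u hu using hb u hu
        refine (eLpNorm_le_of_ae_bound hae).trans (le_of_eq ?_)
        rw [Measure.restrict_apply_univ, Real.volume_Ioc, sub_zero, ENNReal.ofReal_coe_nnreal,
          NNReal.sqrt_eq_rpow]
        simp [ENNReal.coe_rpow_of_nonneg]
      have htri : eLpNorm (s n).toFun 2 μ ≤
          (((1 / (n + 1) + NNReal.sqrt T : ℝ≥0)) : ℝ≥0∞) := by
        have e : (s n).toFun = (fun u => (s n).toFun u - g u) + g := by ext u; simp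
        rw [e, ENNReal.coe_add]
        refine (eLpNorm_add_le ((s n).measurable_toFun.sub hg).aestronglyMeasurable
          hg.aestronglyMeasurable (by norm_num)).trans (add_le_add ((hs1 n).trans ?_) hgn)
        rw [ENNReal.ofReal]
        refine ENNReal.coe_le_coe.2 (le_of_eq ?_)
        apply NNReal.coe_injective
        rw [Real.coe_toNNReal _ (hpos n).le]
        push_cast; rfl
      have := (s n).sqNorm_le.trans (pow_le_pow_left' htri 2)
      exact_mod_cast this
    · refine tendsto_of_tendsto_of_tendsto_of_le_of_le tendsto_const_nhds ?_
        (fun n => zero_le) hs2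
      simpa using ENNReal.tendsto_ofReal (tendsto_one_div_add_atTop_nhds_zero_nat (𝕜 := ℝ))
  -- Without a Wiener integral the default value is 0, which the zero step function approximates
  -- exactly. Existence therefore never has to be proved.
  · rw [wienerIntegral, dif_neg h]
    refine ⟨MemLp.zero, fun _ => StepData.zero T, fun n => ?_, ?_⟩
    · simp [StepData.sqNorm, StepData.zero]
    · simp [StepData.integral, StepData.zero]

lemma mlIntegral_approx {α : ℝ} (hα : 0 < α) (hα1 : α ≤ 1) (l : ℕ) (B : ℝ≥0 → Ω → ℝ) (T : ℝ≥0) :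
    MemLp (mlIntegral P α l B T) 2 P ∧ ∃ s : ℕ → StepData T,
      (∀ n : ℕ, (s n).sqNorm ≤ (1 / (n + 1) + NNReal.sqrt T) ^ 2) ∧
      Tendsto (fun n => eLpNorm (fun ω => (s n).integral B ω - mlIntegral P α l B T ω) 2 P)
        atTop (𝓝 0) := by
  refine wienerIntegral_approx B ?_ fun u hu => ?_
  · have := (continuous_mittagLeffler hα).measurable
    fun_prop
  · rw [neg_mul]
    refine abs_mittagLeffler_neg_le_one hα hα1 (mul_nonneg ?_ (Real.rpow_nonneg ?_ _))
    · unfold sphEigenvalue; positivity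
    · linarith [hu.2]

variable {Z : Fin 2 → ℕ → ℕ → Ω → ℝ}
  {b : Fin 2 → ℕ → ℕ → ℝ≥0 → Ω → ℝ}

/-- Variance proxies add under independence, used three times: among the Z, among the Brownian
motions, and between the two families. -/
lemma hasSubgaussianMGF_elementary (hZb : IsRandomInput P Z b) (F : Finset CoeffIndex)
    (u v : CoeffIndex → ℝ) {T : ℝ≥0} (s : CoeffIndex → StepData T) :
    HasSubgaussianMGF (fun ω => ∑ i ∈ F, u i * Z i.1.1 i.1.2.1 i.1.2.2 ω +
        ∑ i ∈ F, v i * (s i).integral (b i.1.1 i.1.2.1 i.1.2.2) ω)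
      (∑ i ∈ F, ‖u i‖₊ ^ 2 + ∑ i ∈ F, ‖v i‖₊ ^ 2 * (s i).sqNorm) P := by
  have hsq : ∀ (r : ℝ) (c : ℝ≥0) (X : Ω → ℝ), HasSubgaussianMGF X c P →
      HasSubgaussianMGF (fun ω => r * X ω) (‖r‖₊ ^ 2 * c) P := by
    intro r c X h
    refine HasSubgaussianMGF.of_le (h.const_mul r) (le_of_eq ?_)
    apply NNReal.coe_injective
    change r ^ 2 * (c : ℝ) = _
    simp
  have h1 : HasSubgaussianMGF (fun ω => ∑ i ∈ F, u i * Z i.1.1 i.1.2.1 i.1.2.2 ω)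
      (∑ i ∈ F, ‖u i‖₊ ^ 2) P := by
    refine HasSubgaussianMGF.sum_of_iIndepFun
      (hZb.indep_Z.comp (fun i x => u i * x) fun i => by fun_prop) fun i _ => ?_
    have := hsq (u i) 1 _ (hasSubgaussianMGF_of_hasLaw_gaussianReal (hZb.law_Z i))
    rwa [mul_one] at this
  have h2 : HasSubgaussianMGF (fun ω => ∑ i ∈ F, v i * (s i).integral
      (b i.1.1 i.1.2.1 i.1.2.2) ω) (∑ i ∈ F, ‖v i‖₊ ^ 2 * (s i).sqNorm) P := by
    refine HasSubgaussianMGF.sum_of_iIndepFun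
      (hZb.indep_b.comp (fun i (w : ℝ≥0 → ℝ) => v i * ∑ k : Fin (s i).n,
        (s i).vals k * (w ((s i).pts k.succ) - w ((s i).pts k.castSucc))) fun i => by fun_prop)
      fun i _ => ?_
    exact hsq (v i) _ _ ((s i).hasSubgaussianMGF_integral (hZb.brownian_b i))
  refine h1.add_of_indepFun h2 ?_
  exact hZb.indep_Z_b.comp (φ := fun z : CoeffIndex → ℝ => ∑ i ∈ F, u i * z i)
    (ψ := fun w : CoeffIndex → ℝ≥0 → ℝ => ∑ i ∈ F, v i * ∑ k : Fin (s i).n,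
      (s i).vals k * (w i ((s i).pts k.succ) - w i ((s i).pts k.castSucc)))
    (by fun_prop) (by fun_prop)

/-- Limit of the elementary case. The proxies (1/(n+1) + √T)² of the approximating integrals tend to
T because the kernel is bounded by 1. -/
lemma hasSubgaussianMGF_linearCombination (hZb : IsRandomInput P Z b) {α : ℝ} (hα : 0 < α)
    (hα1 : α ≤ 1) (F : Finset CoeffIndex) (u v : CoeffIndex → ℝ) (T : ℝ≥0) :
    HasSubgaussianMGF (fun ω => ∑ i ∈ F, u i * Z i.1.1 i.1.2.1 i.1.2.2 ω +
        ∑ i ∈ F, v i * mlIntegral P α i.1.2.1 (b i.1.1 i.1.2.1 i.1.2.2) T ω)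
      (∑ i ∈ F, ‖u i‖₊ ^ 2 + ∑ i ∈ F, ‖v i‖₊ ^ 2 * T) P := by
  have happ := fun i : CoeffIndex => mlIntegral_approx (P := P) hα hα1 i.1.2.1
    (b i.1.1 i.1.2.1 i.1.2.2) T
  choose hmem s hs hlim using happ
  have hZm : ∀ i : CoeffIndex, AEStronglyMeasurable (Z i.1.1 i.1.2.1 i.1.2.2) P := fun i =>
    (hZb.measurable_Z i).aestronglyMeasurable
  have hSm : ∀ (i : CoeffIndex) n, AEStronglyMeasurable
      ((s i n).integral (b i.1.1 i.1.2.1 i.1.2.2)) P := fun i n =>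
    ((s i n).hasSubgaussianMGF_integral (hZb.brownian_b i)).aestronglyMeasurable
  refine hasSubgaussianMGF_of_tendsto
    (X := fun n ω => ∑ i ∈ F, u i * Z i.1.1 i.1.2.1 i.1.2.2 ω +
        ∑ i ∈ F, v i * (s i n).integral (b i.1.1 i.1.2.1 i.1.2.2) ω)
    (c := fun n : ℕ => ∑ i ∈ F, ‖u i‖₊ ^ 2 +
      ∑ i ∈ F, ‖v i‖₊ ^ 2 * (1 / (n + 1) + NNReal.sqrt T) ^ 2) (fun n => ?_) ?_ ?_ ?_
  · refine HasSubgaussianMGF.of_le (hasSubgaussianMGF_elementary hZb F u v fun i => s i n) ?_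
    gcongr with i _
    exact hs i n
  · have hJm := fun i => (hmem i).aestronglyMeasurable
    exact (Finset.aestronglyMeasurable_fun_sum F fun i _ => (hZm i).const_mul _).add
      (Finset.aestronglyMeasurable_fun_sum F fun i _ => (hJm i).const_mul _)
  · have h0 : Tendsto (fun n : ℕ => (1 / ((n : ℝ≥0) + 1) + NNReal.sqrt T) ^ 2) atTop (𝓝 T) := by
      have := ((tendsto_one_div_add_atTop_nhds_zero_nat (𝕜 := ℝ≥0)).add_const
        (NNReal.sqrt T)).pow 2
      simpa using this
    exact tendsto_const_nhds.add (tendsto_finsetSum _ fun i _ => h0.const_mul _)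
  · have hle : ∀ n, eLpNorm (fun ω => (∑ i ∈ F, u i * Z i.1.1 i.1.2.1 i.1.2.2 ω +
        ∑ i ∈ F, v i * (s i n).integral (b i.1.1 i.1.2.1 i.1.2.2) ω) -
        (∑ i ∈ F, u i * Z i.1.1 i.1.2.1 i.1.2.2 ω +
        ∑ i ∈ F, v i * mlIntegral P α i.1.2.1 (b i.1.1 i.1.2.1 i.1.2.2) T ω)) 2 P ≤
        ∑ i ∈ F, ‖v i‖ₑ * eLpNorm (fun ω => (s i n).integral (b i.1.1 i.1.2.1 i.1.2.2) ω -
          mlIntegral P α i.1.2.1 (b i.1.1 i.1.2.1 i.1.2.2) T ω) 2 P := by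
      intro n
      have e : (fun ω => (∑ i ∈ F, u i * Z i.1.1 i.1.2.1 i.1.2.2 ω +
          ∑ i ∈ F, v i * (s i n).integral (b i.1.1 i.1.2.1 i.1.2.2) ω) -
          (∑ i ∈ F, u i * Z i.1.1 i.1.2.1 i.1.2.2 ω +
          ∑ i ∈ F, v i * mlIntegral P α i.1.2.1 (b i.1.1 i.1.2.1 i.1.2.2) T ω)) =
          ∑ i ∈ F, v i • (fun ω => (s i n).integral (b i.1.1 i.1.2.1 i.1.2.2) ω -
            mlIntegral P α i.1.2.1 (b i.1.1 i.1.2.1 i.1.2.2) T ω) := by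
        ext ω
        simp [Finset.sum_apply, mul_sub]
      rw [e]
      refine (eLpNorm_sum_le (fun i _ => ((hSm i n).sub
        (hmem i).aestronglyMeasurable).const_smul _) (by norm_num)).trans (le_of_eq ?_)
      exact Finset.sum_congr rfl fun i _ => eLpNorm_const_smul _ _ _ _
    refine tendsto_of_tendsto_of_tendsto_of_le_of_le tendsto_const_nhds ?_
      (fun n => zero_le) hle
    have := tendsto_finsetSum F fun i _ =>
      ENNReal.Tendsto.const_mul (a := ‖v i‖ₑ) (hlim i) (Or.inr enorm_ne_top)
    simpa using this

end Wiener

/-! ### Increments of the solution -/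

lemma DecaysAlgebraically.summable_spectralTerm {C : ℕ → ℝ} {κ β : ℝ}
    (hC : DecaysAlgebraically C κ) (hκ : 2 * (1 + β) < κ) : Summable (spectralTerm β C) := by
  obtain ⟨h0, D, K, -, -, -, hK⟩ := hC
  have hs : Summable fun k : ℕ => K * ((k + 1 : ℕ) : ℝ) ^ (1 + 2 * β - κ) :=
    ((summable_nat_add_iff 1).2 (Real.summable_nat_rpow.2 (by linarith))).mul_left K
  refine Summable.of_nonneg_of_le (fun k => ?_) (fun k => ?_) hs
  · have := h0 (k + 1)
    unfold spectralTerm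
    positivity
  · have h1 := hK (k + 1) (by omega)
    have h2 : (0 : ℝ) < ((k + 1 : ℕ) : ℝ) := by positivity
    calc spectralTerm β C k ≤ ((k + 1 : ℕ) : ℝ) ^ (1 + 2 * β) *
          (K * ((k + 1 : ℕ) : ℝ) ^ (-κ)) := by
          unfold spectralTerm; gcongr
      _ = _ := by
          rw [sub_eq_add_neg (1 + 2 * β) κ, Real.rpow_add h2 (1 + 2 * β) (-κ)]; ring

lemma spectralTerm_nonneg {C : ℕ → ℝ} (hC : ∀ l, 0 ≤ C l) (β : ℝ) (k : ℕ) :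
    0 ≤ spectralTerm β C k := by
  have := hC (k + 1)
  unfold spectralTerm
  positivity

lemma sum_mul_sphIncrement_le {C : ℕ → ℝ} (hC : ∀ l, 0 ≤ C l) {β : ℝ} (hβ : 0 < β) (hβ1 : β ≤ 1)
    (hs : Summable (spectralTerm β C)) (L : ℕ) (x y : Sphere2) :
    ∑ l ∈ Finset.range (L + 1), C l * sphIncrement l x y ≤
      (2 : ℝ) ^ (4 - β) * spectralMoment β C * geodesicDist x y ^ (2 * β) := by
  rw [Finset.sum_range_succ', sphIncrement_zero, mul_zero, add_zero]
  have hθ : 0 ≤ geodesicDist x y ^ (2 * β) := Real.rpow_nonneg (geodesicDist_nonneg x y) _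
  calc _ ≤ ∑ k ∈ Finset.range L, (2 : ℝ) ^ (4 - β) * geodesicDist x y ^ (2 * β) *
        spectralTerm β C k := by
        refine Finset.sum_le_sum fun k _ => ?_
        refine (mul_le_mul_of_nonneg_left (sphIncrement_le hβ hβ1 (Nat.le_add_left 1 k) x y)
          (hC (k + 1))).trans (le_of_eq ?_)
        unfold spectralTerm
        ring
    _ ≤ (2 : ℝ) ^ (4 - β) * geodesicDist x y ^ (2 * β) * spectralMoment β C := by
        rw [← Finset.mul_sum]
        exact mul_le_mul_of_nonneg_left (hs.sum_le_tsum _ fun k _ => spectralTerm_nonneg hC β k)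
          (by positivity)
    _ = _ := by ring

lemma incrementConst_nonneg {C A : ℕ → ℝ} (hC : ∀ l, 0 ≤ C l) (hA : ∀ l, 0 ≤ A l) (β τ t : ℝ) :
    0 ≤ incrementConst β τ C A t := by
  have h1 : 0 ≤ spectralMoment β C := tsum_nonneg fun k => spectralTerm_nonneg hC β k
  have h2 : 0 ≤ spectralMoment β A := tsum_nonneg fun k => spectralTerm_nonneg hA β k
  unfold incrementConst
  refine mul_nonneg (by positivity) ?_
  split_ifs with h
  · exact h1
  · have : 0 ≤ t - τ := by linarith
    positivity

section Solution

variable {Ω : Type*} [MeasurableSpace Ω] {P : Measure Ω} {Z : Fin 2 → ℕ → ℕ → Ω → ℝ}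
  {b : Fin 2 → ℕ → ℕ → ℝ≥0 → Ω → ℝ}

lemma truncatedSolution_eq {C A : ℕ → ℝ} (hC : ∀ l, 0 ≤ C l) (hA : ∀ l, 0 ≤ A l) (α τ : ℝ)
    (L : ℕ) (t : ℝ) (x : Sphere2) (ω : Ω) :
    truncatedSolution P α τ C A Z b L t x ω =
      ∑ i ∈ coeffFinset L, mittagLeffler α (-(sphEigenvalue i.1.2.1) * t ^ α) *
        Real.sqrt (C i.1.2.1) * realSphHarm i.1.1 i.1.2.1 i.1.2.2 x * Z i.1.1 i.1.2.1 i.1.2.2 ω +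
      ∑ i ∈ coeffFinset L, (if t ≤ τ then 0 else Real.sqrt (A i.1.2.1)) *
        realSphHarm i.1.1 i.1.2.1 i.1.2.2 x *
          mlIntegral P α i.1.2.1 (b i.1.1 i.1.2.1 i.1.2.2) (t - τ).toNNReal ω := by
  rw [sum_coeffFinset L fun j l m => mittagLeffler α (-(sphEigenvalue l) * t ^ α) *
      Real.sqrt (C l) * realSphHarm j l m x * Z j l m ω,
    sum_coeffFinset L fun j l m => (if t ≤ τ then 0 else Real.sqrt (A l)) *
        realSphHarm j l m x * mlIntegral P α l (b j l m) (t - τ).toNNReal ω,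
    ← Finset.sum_add_distrib, truncatedSolution]
  refine Finset.sum_congr rfl fun l _ => ?_
  congr 1
  · rw [homPart, harmonicPart_eq (hC l), mul_add, Finset.mul_sum]
    congr 1
    · ring
    · exact Finset.sum_congr rfl fun m _ => by ring
  · rw [inhomPart]
    split_ifs with h
    · simp
    · exact harmonicPart_eq (hA l) _ l x ω

lemma sum_coeffFinset_sq (L : ℕ) (a : ℕ → ℝ) (x y : Sphere2) :
    ((∑ i ∈ coeffFinset L, ‖a i.1.2.1 * (realSphHarm i.1.1 i.1.2.1 i.1.2.2 x -
      realSphHarm i.1.1 i.1.2.1 i.1.2.2 y)‖₊ ^ 2 : ℝ≥0) : ℝ) =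
      ∑ l ∈ Finset.range (L + 1), a l ^ 2 * sphIncrement l x y := by
  push_cast
  simp only [Real.norm_eq_abs, sq_abs]
  rw [sum_coeffFinset L fun j l m => (a l * (realSphHarm j l m x - realSphHarm j l m y)) ^ 2]
  refine Finset.sum_congr rfl fun l _ => ?_
  rw [← sum_sq_realSphHarm_sub, mul_add, Finset.mul_sum]
  simp only [mul_pow, mul_add]

/-- Within a degree the squared increments of the real harmonics add up to `sphIncrement`. The bound
is uniform in the truncation L, as the passage to the series requires. -/
lemma hasSubgaussianMGF_truncatedSolution_sub (hZb : IsRandomInput P Z b) {α τ : ℝ} (hα : 0 < α)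
    (hα1 : α ≤ 1) {C A : ℕ → ℝ} (hC : ∀ l, 0 ≤ C l) (hA : ∀ l, 0 ≤ A l) {β : ℝ} (hβ : 0 < β)
    (hβ1 : β ≤ 1) (hsC : Summable (spectralTerm β C)) (hsA : Summable (spectralTerm β A))
    (L : ℕ) {t : ℝ} (ht : 0 < t) (x y : Sphere2) :
    HasSubgaussianMGF (fun ω => truncatedSolution P α τ C A Z b L t x ω -
        truncatedSolution P α τ C A Z b L t y ω)
      (incrementConst β τ C A t * geodesicDist x y ^ (2 * β)).toNNReal P := by
  set aC : ℕ → ℝ := fun l => mittagLeffler α (-(sphEigenvalue l) * t ^ α) * Real.sqrt (C l)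
  set aA : ℕ → ℝ := fun l => if t ≤ τ then 0 else Real.sqrt (A l) with haA
  have h := hasSubgaussianMGF_linearCombination hZb hα hα1 (coeffFinset L)
    (fun i => aC i.1.2.1 * (realSphHarm i.1.1 i.1.2.1 i.1.2.2 x -
      realSphHarm i.1.1 i.1.2.1 i.1.2.2 y))
    (fun i => aA i.1.2.1 * (realSphHarm i.1.1 i.1.2.1 i.1.2.2 x -
      realSphHarm i.1.1 i.1.2.1 i.1.2.2 y)) (t - τ).toNNReal
  have hfun : (fun ω => truncatedSolution P α τ C A Z b L t x ω -
        truncatedSolution P α τ C A Z b L t y ω) = fun ω =>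
      ∑ i ∈ coeffFinset L, aC i.1.2.1 * (realSphHarm i.1.1 i.1.2.1 i.1.2.2 x -
        realSphHarm i.1.1 i.1.2.1 i.1.2.2 y) * Z i.1.1 i.1.2.1 i.1.2.2 ω +
      ∑ i ∈ coeffFinset L, aA i.1.2.1 * (realSphHarm i.1.1 i.1.2.1 i.1.2.2 x -
        realSphHarm i.1.1 i.1.2.1 i.1.2.2 y) *
        mlIntegral P α i.1.2.1 (b i.1.1 i.1.2.1 i.1.2.2) (t - τ).toNNReal ω := by
    funext ω
    rw [truncatedSolution_eq hC hA, truncatedSolution_eq hC hA, add_sub_add_comm,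
      ← Finset.sum_sub_distrib, ← Finset.sum_sub_distrib]
    congr 1 <;> exact Finset.sum_congr rfl fun i _ => by ring
  rw [hfun]
  refine HasSubgaussianMGF.of_le h ?_
  rw [← NNReal.coe_le_coe, ← Finset.sum_mul, NNReal.coe_add, NNReal.coe_mul,
    sum_coeffFinset_sq, sum_coeffFinset_sq,
    Real.coe_toNNReal _ (mul_nonneg (incrementConst_nonneg hC hA _ _ _)
      (Real.rpow_nonneg (geodesicDist_nonneg x y) _))]
  have h1 : ∑ l ∈ Finset.range (L + 1), aC l ^ 2 * sphIncrement l x y ≤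
      (2 : ℝ) ^ (4 - β) * spectralMoment β C * geodesicDist x y ^ (2 * β) := by
    refine le_trans (Finset.sum_le_sum fun l _ => ?_)
      (sum_mul_sphIncrement_le hC hβ hβ1 hsC L x y)
    refine mul_le_mul_of_nonneg_right ?_ (sphIncrement_nonneg l x y)
    have hml : |mittagLeffler α (-(sphEigenvalue l) * t ^ α)| ≤ 1 := by
      rw [neg_mul]
      refine abs_mittagLeffler_neg_le_one hα hα1 (mul_nonneg ?_ (Real.rpow_nonneg ht.le _))
      unfold sphEigenvalue; positivity
    rw [mul_pow, Real.sq_sqrt (hC l)]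
    exact mul_le_of_le_one_left (hC l) ((sq_le_one_iff_abs_le_one _).2 hml)
  unfold incrementConst
  by_cases hτ : t ≤ τ
  · simp only [hτ, if_true, haA, ne_eq, OfNat.ofNat_ne_zero, not_false_eq_true, zero_pow, zero_mul,
      Finset.sum_const_zero, add_zero]
    exact h1
  · have h2 : ∑ l ∈ Finset.range (L + 1), aA l ^ 2 * sphIncrement l x y ≤
        (2 : ℝ) ^ (4 - β) * spectralMoment β A * geodesicDist x y ^ (2 * β) := by
      refine le_trans (le_of_eq (Finset.sum_congr rfl fun l _ => ?_))
        (sum_mul_sphIncrement_le hA hβ hβ1 hsA L x y)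
      simp only [haA, hτ, if_false]
      rw [Real.sq_sqrt (hA l)]
    have ht' : 0 ≤ t - τ := by linarith
    rw [if_neg hτ, Real.coe_toNNReal _ ht']
    have h3 := mul_le_mul_of_nonneg_right h2 ht'
    refine (add_le_add h1 h3).trans (le_of_eq ?_)
    ring

lemma hasSubgaussianMGF_solution_sub (hZb : IsRandomInput P Z b) {α τ : ℝ} (hα : 0 < α)
    (hα1 : α ≤ 1) {C A : ℕ → ℝ} (hC : ∀ l, 0 ≤ C l) (hA : ∀ l, 0 ≤ A l) {β : ℝ} (hβ : 0 < β)
    (hβ1 : β ≤ 1) (hsC : Summable (spectralTerm β C)) (hsA : Summable (spectralTerm β A))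
    {U : ℝ → Sphere2 → Ω → ℝ} (hU : IsSolutionField P α τ C A Z b U) {t : ℝ} (ht : 0 < t)
    (x y : Sphere2) :
    HasSubgaussianMGF (fun ω => U t x ω - U t y ω)
      (incrementConst β τ C A t * geodesicDist x y ^ (2 * β)).toNNReal P := by
  obtain ⟨hx, hxlim⟩ := hU t ht x
  obtain ⟨hy, hylim⟩ := hU t ht y
  have hZm : ∀ i : CoeffIndex, AEStronglyMeasurable (Z i.1.1 i.1.2.1 i.1.2.2) P := fun i =>
    (hZb.measurable_Z i).aestronglyMeasurable
  have hJm := fun i : CoeffIndex => (mlIntegral_approx (P := P) hα hα1 i.1.2.1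
    (b i.1.1 i.1.2.1 i.1.2.2) (t - τ).toNNReal).1.aestronglyMeasurable
  have htm : ∀ L z, AEStronglyMeasurable (truncatedSolution P α τ C A Z b L t z) P := by
    intro L z
    have e : truncatedSolution P α τ C A Z b L t z = _ :=
      funext fun ω => truncatedSolution_eq hC hA α τ L t z ω
    rw [e]
    exact (Finset.aestronglyMeasurable_fun_sum _ fun i _ => (hZm i).const_mul _).add
      (Finset.aestronglyMeasurable_fun_sum _ fun i _ => (hJm i).const_mul _)
  refine hasSubgaussianMGF_of_tendsto (fun L => hasSubgaussianMGF_truncatedSolution_sub hZb hα hα1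
    hC hA hβ hβ1 hsC hsA L ht x y) (hx.aestronglyMeasurable.sub hy.aestronglyMeasurable)
    tendsto_const_nhds ?_
  refine tendsto_of_tendsto_of_tendsto_of_le_of_le tendsto_const_nhds
    (by simpa using hxlim.add hylim) (fun L => zero_le) fun L => ?_
  have e : (fun ω => truncatedSolution P α τ C A Z b L t x ω -
      truncatedSolution P α τ C A Z b L t y ω - (U t x ω - U t y ω)) =
      (fun ω => truncatedSolution P α τ C A Z b L t x ω - U t x ω) -
      (fun ω => truncatedSolution P α τ C A Z b L t y ω - U t y ω) := by
    ext ω; simp; ring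
  beta_reduce
  rw [e]
  exact eLpNorm_sub_le ((htm L x).sub hx.aestronglyMeasurable)
    ((htm L y).sub hy.aestronglyMeasurable) (by norm_num)

end Solution

end

/-! ### The variance bound and the Hölder modification -/

theorem theorem6p3 {Ω : Type*} [MeasurableSpace Ω] (P : Measure Ω) [IsProbabilityMeasure P]
    (α τ : ℝ) (hα : 0 < α) (hα1 : α ≤ 1) (hτ : 0 ≤ τ)
    (Z : Fin 2 → ℕ → ℕ → Ω → ℝ) (b : Fin 2 → ℕ → ℕ → ℝ≥0 → Ω → ℝ)
    (hZb : IsRandomInput P Z b)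
    (βs κ₁ κ₂ : ℝ) (hβ : 0 < βs) (hβ1 : βs ≤ 1)
    (hκ₁ : 2 * (1 + βs) < κ₁) (hκ₂ : 2 * (1 + βs) < κ₂)
    (C A : ℕ → ℝ) (hC : DecaysAlgebraically C κ₁) (hA : DecaysAlgebraically A κ₂)
    (U : ℝ → Sphere2 → Ω → ℝ) (hU : IsSolutionField P α τ C A Z b U) :
    Summable (spectralTerm βs C) ∧ Summable (spectralTerm βs A) ∧
    ∀ t : ℝ, 0 < t →
      (∀ x y : Sphere2,
        variance (fun ω => U t x ω - U t y ω) P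
          ≤ incrementConst βs τ C A t * geodesicDist x y ^ (2 * βs)) ∧
      ∃ V : Sphere2 → Ω → ℝ,
        Measurable (Function.uncurry V) ∧
        (∀ x : Sphere2, V x =ᵐ[P] U t x) ∧
        ∀ ω : Ω, ∀ γ : ℝ, 0 < γ → γ < βs → LocallyHolderSphere (fun x => V x ω) γ := by
  have hsC := hC.summable_spectralTerm hκ₁
  have hsA := hA.summable_spectralTerm hκ₂
  refine ⟨hsC, hsA, fun t ht => ?_⟩
  have hsub := hasSubgaussianMGF_solution_sub hZb hα hα1 hC.1 hA.1 hβ hβ1 hsC hsA hU ht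
  set K := incrementConst βs τ C A t
  have hK : 0 ≤ K := incrementConst_nonneg hC.1 hA.1 _ _ _
  refine ⟨fun x y => ?_, ?_⟩
  · refine (hsub x y).variance_le.trans (le_of_eq (Real.coe_toNNReal _ ?_))
    exact mul_nonneg hK (Real.rpow_nonneg (geodesicDist_nonneg x y) _)
  · have hUm := fun x => (hU t ht x).1.aestronglyMeasurable.aemeasurable
    -- Each U(x,t) is only almost everywhere measurable, so chaining is applied to measurable
    -- versions.
    set X : Sphere2 → Ω → ℝ := fun x => (hUm x).mk (U t x)
    have hXm : ∀ x, Measurable (X x) := fun x => (hUm x).measurable_mk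
    have hXU : ∀ x, U t x =ᵐ[P] X x := fun x => (hUm x).ae_eq_mk
    have hmom : ∀ k : ℕ, k ≠ 0 → ∃ M : ℝ, 0 ≤ M ∧ ∀ x y,
        ∫⁻ ω, ENNReal.ofReal ((X x ω - X y ω) ^ (2 * k)) ∂P ≤
          ENNReal.ofReal (M * dist x y ^ (2 * k * βs)) := by
      intro k hk
      -- K+1 replaces K because the moment bound needs a strictly positive proxy. The factor 2^{2β}
      -- comes from passing from the geodesic to the chordal distance.
      refine ⟨(2 * k).factorial * (2 * Real.exp (1 / 2)) * ((K + 1) * 2 ^ (2 * βs)) ^ k,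
        by positivity, fun x y => ?_⟩
      rcases eq_or_ne x y with rfl | hne
      · simp [hk]
      have hd : 0 < dist x y := dist_pos.2 hne
      set c : ℝ := (K + 1) * (2 * dist x y) ^ (2 * βs) with hc
      have hc0 : 0 < c := by positivity
      have h1 : HasSubgaussianMGF (fun ω => X x ω - X y ω) c.toNNReal P := by
        refine HasSubgaussianMGF.of_le ((hsub x y).congr ?_) (Real.toNNReal_le_toNNReal ?_)
        · filter_upwards [hXU x, hXU y] with ω h1 h2
          rw [h1, h2]
        · have := geodesicDist_le_dist x y
          have := geodesicDist_nonneg x y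
          rw [hc]
          gcongr
          linarith
      refine (h1.lintegral_pow_le (Real.toNNReal_pos.2 hc0) k).trans
        (ENNReal.ofReal_le_ofReal (le_of_eq ?_))
      rw [Real.coe_toNNReal _ hc0.le, hc, Real.mul_rpow (by norm_num) hd.le, mul_assoc _ (_ ^ k),
        show 2 * (k : ℝ) * βs = 2 * βs * k by ring, Real.rpow_mul_natCast hd.le, ← mul_pow,
        mul_assoc (K + 1)]
    obtain ⟨V, hV1, hV2, hV3⟩ := exists_holder_modification hXm hβ hmom measurable_gridPoint
      gridPoint_mem card_gridNet_le dist_gridPoint_le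
    refine ⟨V, hV1, fun x => (hV2 x).trans (hXU x).symm, fun ω γ hγ hγβ x₀ => ?_⟩
    obtain ⟨K', hK'⟩ := hV3 ω γ hγ hγβ
    -- Radius 1/2 keeps any two points within chordal distance 1, the range of the chaining bound.
    refine ⟨Metric.ball x₀ (1 / 2), Metric.ball_mem_nhds _ (by norm_num), |K'|,
      fun x hx y hy => ?_⟩
    have hxy : dist x y ≤ 1 := by
      have h1 := dist_triangle_right x y x₀
      have h2 := Metric.mem_ball.1 hx
      have h3 := Metric.mem_ball.1 hy
      linarith
    calc |V x ω - V y ω| ≤ K' * dist x y ^ γ := hK' x y hxy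
      _ ≤ |K'| * geodesicDist x y ^ γ := by
          have := dist_le_geodesicDist x y
          gcongr
          exact le_abs_self K'
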